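/- **Theorem (Family of error-correcting $2\mathrm{I}$ codes).** Notation: let $\varphi=(1+\sqrt5)/2$ and let $\mathsf X=-i\begin{pmatrix}0&1\\1&0\end{pmatrix}$, $\mathsf Z=-i\begin{pmatrix}1&0\\0&-1\end{pmatrix}$, $\mathsf F=\tfrac{e^{-i\pi/4}}{\sqrt2}\begin{pmatrix}1&-i\\1&i\end{pmatrix}$, $\mathsf\Phi=\tfrac12\begin{pmatrix}\varphi+i\varphi^{-1}&1\\-1&\varphi-i\varphi^{-1}\end{pmatrix}$, $\mathsf\Phi^\star=\tfrac12\begin{pmatrix}-\varphi^{-1}+i\varphi&1\\-1&-\varphi^{-1}-i\varphi\end{pmatrix}$. The binary icosahedral group is $2\mathrm I=\langle\mathsf X,\mathsf Z,\mathsf F,\mathsf\Phi\rangle\subset\mathrm{SU}(2)$; a second (conjugate) version of it is $2\mathrm I^\star=\langle\mathsf X,\mathsf Z,\mathsf F,\mathsf\Phi^\star\rangle$. Let $\overline{\pi_2}$ be the two-dimensional irreducible representation of $2\mathrm I$ whose character is obtained from $g\mapsto\operatorname{tr} g$ (which has values in $\mathbb Q(\sqrt5)$) by $\sqrt5\mapsto-\sqrt5$.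 For $n=2j$ let $D^j$ be the $(n+1)$-dimensional spin-$j$ representation of $\mathrm{SU}(2)$ (Wigner rotation operators), with its standard orthonormal basis $|j,m\rangle$, $m=j,j-1,\dots,-j$. Let $|D^n_w\rangle=\binom nw^{-1/2}\sum_{\mathrm{wt}(s)=w}|s\rangle\in(\mathbb C^2)^{\otimes n}$ (Dicke states), and let $\mathscr D$ be the linear map $|j,m\rangle\mapsto|D^n_{j-m}\rangle$. An $((n,K,d))$ code is a $K$-dimensional subspace $C\subseteq(\mathbb C^2)^{\otimes n}$ satisfying the Knill-Laflamme conditions for all Pauli errors $E$ of weight less than $d$: there is a constant $c_E$ with $\langle u|E|v\rangle=c_E\langle u|v\rangle$ for all $u,v\in C$. It is permutationally invariant if every vector of $C$ is fixed by all permutations of the qubits. For a group $\mathsf G\subset\mathrm{SU}(2)$ and an orthonormal basis $|b_0\rangle,|b_1\rangle$ of a two-dimensional code, the code implements $\mathsf G$ (strongly) transversally in that logical basis if for every $g\in\mathsf G$ there is $h\in\mathrm U(2)$ with $h^{\otimes n}|b_k\rangle=\sum_{l}g_{lk}|b_l\rangle$ for $k=0,1$. Statement: for every odd natural number $n\notin\{1,3,5,9,11,15,21\}$,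 with $j=n/2$, there are orthonormal vectors $u_0,u_1$ in the spin-$j$ space, with real coefficients in the basis $|j,m\rangle$, such that 1. $\operatorname{span}(u_0,u_1)$ is invariant under $D^j(g)$ for all $g\in2\mathrm I$, and $2\mathrm I$ acts on it by the irrep $\overline{\pi_2}$; 2. $C=\mathscr D(\operatorname{span}(u_0,u_1))$ is a permutationally invariant $((n,2,3))$ code; 3. $C$ implements the binary icosahedral group transversally by gates of the form $h^{\otimes n}$: in the logical basis $|\overline0\rangle=\mathscr Du_0$, $|\overline1\rangle=\mathscr Du_1$ it implements $2\mathrm I^\star$, and in a suitable orthonormal basis of $C$ it implements $2\mathrm I$. -/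

import Mathlib

open scoped BigOperators

noncomputable section

namespace IcosahedralCodes

/-! ### Single-qubit gates and the binary icosahedral group -/

/-- The special unitary group `SU(2)`. -/
abbrev SU2 : Type := Matrix.specialUnitaryGroup (Fin 2) ℂ

/-- A matrix `[[a, b], [-b̄, ā]]` with `|a|² + |b|² = 1`, as an element of `SU(2)`. -/
def su2Mk (a b : ℂ) (h : a * star a + b * star b = 1) : SU2 :=
  ⟨!![a, b; -star b, star a], by
    rw [Matrix.mem_specialUnitaryGroup_iff]
    constructor
    · rw [Matrix.mem_unitaryGroup_iff]
      ext i j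
      fin_cases i <;> fin_cases j <;>
        simp [Matrix.mul_apply, Fin.sum_univ_two, Matrix.star_apply] at h ⊢ <;>
        first
          | exact h
          | ring1
          | (rw [← h]; ring1)
    · rw [Matrix.det_fin_two_of, ← h]; ring⟩

/-- `𝖷 = -i X = [[0, -i], [-i, 0]]`. -/
def gateX : SU2 := su2Mk 0 (-Complex.I) (by simp)

/-- `𝖹 = -i Z = [[-i, 0], [0, i]]`. -/
def gateZ : SU2 := su2Mk (-Complex.I) 0 (by simp)

/-- The facet gate `𝖥 = (e^{-iπ/4}/√2) [[1, -i], [1, i]] = (1/2) [[1 - i, -1 - i], [1 - i, 1 + i]]`. -/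
def gateF : SU2 := su2Mk ((1 - Complex.I) / 2) ((-1 - Complex.I) / 2) (by
  apply Complex.ext <;> simp <;> norm_num)

/-- `Φ = (1/2) [[φ + i φ⁻¹, 1], [-1, φ - i φ⁻¹]]`, where `φ = (1 + √5)/2`. -/
def gatePhi : SU2 :=
  su2Mk (((Real.goldenRatio / 2 : ℝ) : ℂ) + Complex.I * ((Real.goldenRatio⁻¹ / 2 : ℝ) : ℂ))
    (1 / 2) (by
    have h5 : √5 * √5 = (5 : ℝ) := Real.mul_self_sqrt (by norm_num)
    rw [Real.inv_goldenRatio, Real.goldenRatio, Real.goldenConj]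
    apply Complex.ext <;> simp <;> nlinarith)

/-- `Φ⋆`: replace `√5` by `-√5` in `Φ` (so `φ ↦ -φ⁻¹`, `φ⁻¹ ↦ -φ`), then conjugate entrywise:
`Φ⋆ = (1/2) [[-φ⁻¹ + i φ, 1], [-1, -φ⁻¹ - i φ]]`. -/
def gatePhiStar : SU2 :=
  su2Mk (((-Real.goldenRatio⁻¹ / 2 : ℝ) : ℂ) + Complex.I * ((Real.goldenRatio / 2 : ℝ) : ℂ))
    (1 / 2) (by
    have h5 : √5 * √5 = (5 : ℝ) := Real.mul_self_sqrt (by norm_num)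
    rw [Real.inv_goldenRatio, Real.goldenRatio, Real.goldenConj]
    apply Complex.ext <;> simp <;> nlinarith)

/-- The binary icosahedral group `2I = ⟨𝖷, 𝖹, 𝖥, Φ⟩ ⊂ SU(2)`. -/
def twoI : Subgroup SU2 := Subgroup.closure {gateX, gateZ, gateF, gatePhi}

/-- The other version `⟨𝖷, 𝖹, 𝖥, Φ⋆⟩` of the binary icosahedral group in `SU(2)`. -/
def twoIStar : Subgroup SU2 := Subgroup.closure {gateX, gateZ, gateF, gatePhiStar}

/-! ### Spin systems -/

/-- The state space of a spin `j = n/2`. The coordinate `w ∈ {0, …, n}` is the coefficient of the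
orthonormal basis vector `|j, m⟩` with `m = j - w`. -/
abbrev SpinSpace (n : ℕ) : Type := EuclideanSpace ℂ (Fin (n + 1))

/-- Matrix of the Wigner rotation operator `D^j(g)`, `j = n/2`, in the basis `|j, j - w⟩`. It is
the action of `g = [[a, b], [c, d]]` on binary forms of degree `n` by `x ↦ a x + c y`,
`y ↦ b x + d y`, with `|j, j - w⟩ = x^(n-w) y^w / √((n-w)! w!)`; here `x` is set to `1` and `y` is
the polynomial variable. -/
def wignerMatrix (n : ℕ) (g : Matrix (Fin 2) (Fin 2) ℂ) :
    Matrix (Fin (n + 1)) (Fin (n + 1)) ℂ :=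
  Matrix.of fun v w =>
    ((Real.sqrt (((n - (v : ℕ)).factorial * (v : ℕ).factorial : ℕ) : ℝ) /
      Real.sqrt (((n - (w : ℕ)).factorial * (w : ℕ).factorial : ℕ) : ℝ) : ℝ) : ℂ) *
    ((Polynomial.C (g 0 0) + Polynomial.C (g 1 0) * Polynomial.X) ^ (n - (w : ℕ)) *
      (Polynomial.C (g 0 1) + Polynomial.C (g 1 1) * Polynomial.X) ^ (w : ℕ)).coeff (v : ℕ)

/-- The Wigner rotation operator `D^j(g)`, `j = n/2`. -/
def wignerD (n : ℕ) (g : SU2) : SpinSpace n →ₗ[ℂ] SpinSpace n :=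
  Matrix.toEuclideanLin (wignerMatrix n g.1)

/-- The spin code `S` transforms in the irrep `π̄₂` of `2I`: it is invariant under `D^j(g)` for all
`g ∈ 2I`, and the resulting representation has the character of `π̄₂`, which is obtained from the
character `g ↦ tr g` of the fundamental representation by `√5 ↦ -√5`. -/
def TransformsInPiBarTwo {n : ℕ} (S : Submodule ℂ (SpinSpace n)) : Prop :=
  ∃ hS : ∀ g ∈ twoI, ∀ v ∈ S, wignerD n g v ∈ S,
    ∀ (g : SU2) (hg : g ∈ twoI), ∃ a b : ℚ,
      Matrix.trace g.1 = (a : ℂ) + (b : ℂ) * (√5 : ℝ) ∧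
      LinearMap.trace ℂ S ((wignerD n g).restrict (hS g hg)) = (a : ℂ) - (b : ℂ) * (√5 : ℝ)

/-! ### Multiqubit codes -/

/-- The state space of `n` qubits; the coordinates are indexed by bit strings. -/
abbrev Qubits (n : ℕ) : Type := EuclideanSpace ℂ (Fin n → Fin 2)

/-- The operator `A₁ ⊗ ⋯ ⊗ Aₙ` on `n` qubits. -/
def tensorOp {n : ℕ} (A : Fin n → Matrix (Fin 2) (Fin 2) ℂ) : Qubits n →ₗ[ℂ] Qubits n :=
  Matrix.toEuclideanLin (Matrix.of fun s t => ∏ i, A i (s i) (t i))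

/-- The Pauli matrices `I, X, Y, Z`. -/
def pauli : Fin 4 → Matrix (Fin 2) (Fin 2) ℂ :=
  ![1, !![0, 1; 1, 0], !![0, -Complex.I; Complex.I, 0], !![1, 0; 0, -1]]

/-- The number of tensor factors of a Pauli string that are not the identity. -/
def pauliWeight {n : ℕ} (p : Fin n → Fin 4) : ℕ := (Finset.univ.filter fun i => p i ≠ 0).card

/-- `C` has distance (at least) `d`: the Knill-Laflamme conditions `⟨u|E|v⟩ = c_E ⟨u|v⟩` hold on
`C` for all Pauli errors `E` of weight less than `d`. -/
def HasDistance {n : ℕ} (d : ℕ) (C : Submodule ℂ (Qubits n)) : Prop :=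
  ∀ p : Fin n → Fin 4, pauliWeight p < d → ∃ c : ℂ, ∀ u ∈ C, ∀ v ∈ C,
    inner ℂ u (tensorOp (fun i => pauli (p i)) v) = c * inner ℂ u v

/-- `C` is an `((n, K, d))` code. -/
def IsCode (n K d : ℕ) (C : Submodule ℂ (Qubits n)) : Prop :=
  Module.finrank ℂ C = K ∧ HasDistance d C

/-- Every codeword is fixed by all permutations of the qubits. -/
def IsPermutationallyInvariant {n : ℕ} (C : Submodule ℂ (Qubits n)) : Prop :=
  ∀ v ∈ C, ∀ (σ : Equiv.Perm (Fin n)) (s : Fin n → Fin 2), v (s ∘ σ) = v s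

/-- With the codewords `b 0 = |0̄⟩`, `b 1 = |1̄⟩` as the logical basis, every logical gate `g ∈ G`
is implemented by a physical gate `h ⊗ ⋯ ⊗ h` with `h ∈ U(2)`. -/
def ImplementsStronglyTransversally {n : ℕ} (G : Subgroup SU2) (b : Fin 2 → Qubits n) : Prop :=
  ∀ g ∈ G, ∃ h ∈ Matrix.unitaryGroup (Fin 2) ℂ, ∀ k : Fin 2,
    tensorOp (fun _ : Fin n => h) (b k) = ∑ l : Fin 2, g.1 l k • b l

/-! ### The Dicke state map -/

/-- The Hamming weight of a bit string. -/
def hammingWeight {n : ℕ} (s : Fin n → Fin 2) : ℕ := (Finset.univ.filter fun i => s i = 1).card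

/-- The Dicke state `|D^n_w⟩`: the normalized uniform superposition of the bit strings of Hamming
weight `w`. -/
def dickeState (n w : ℕ) : Qubits n :=
  WithLp.toLp 2 fun s =>
    if hammingWeight s = w then ((1 / Real.sqrt (n.choose w : ℝ) : ℝ) : ℂ) else 0

/-- The Dicke state map `|j, m⟩ ↦ |D^{2j}_{j-m}⟩` with `n = 2j`. -/
def dickeMap (n : ℕ) : SpinSpace n →ₗ[ℂ] Qubits n where
  toFun v := ∑ w : Fin (n + 1), v w • dickeState n (w : ℕ)
  map_add' u v := by simp [add_smul, Finset.sum_add_distrib]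
  map_smul' c v := by simp [mul_smul, Finset.smul_sum]

end IcosahedralCodes

end

open IcosahedralCodes

open IcosahedralCodes
namespace IcosahedralCodes

/-! A spin-`n/2` state is a binary form of degree `n`, on which `D^j(g)` acts by linear
substitution. It suffices to find a nonzero pair of real forms that transforms, under substitution
by `g`, by the matrix `r` obtained from `g` by `√5 ↦ -√5`. Galois conjugation is encoded as the
subgroup of `SU2 × SU2` generated by `galoisGenerators`, so covariance is verified on four
generators only.

Such a pair gives the code. `Z` and `X` force the two states to be orthogonal and of equal norm
(`exists_orthonormal_of_covariant`), and the Dicke map is an isometry turning `D^j(g)` into `g ⊗ ⋯ ⊗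
g` (`tensorOp_dickeMap`). Hence the physical gate `g` implements the logical gate `r`.

The distance is pure representation theory. The matrix elements of two-site operators form a
bilinear map on `2 × 2` matrices that intertwines conjugation by `g` with conjugation by `r`. The
source `(1 + 3) ⊗ (1 + 3)` contains only the irreps `1`, `3`, `5`; the target is `1 + 3'`, where
`3'` is the Galois conjugate of `3`. So all values are scalar, which is the Knill-Laflamme condition
for weight at most two (`equivariant_apply_pauli_pauli`).

For existence, one covariant pair lives in degree 7. Covariant traceless matrices of forms exist in
degrees 6 and 10, and multiplying a pair by them raises its degree. Invariants of degrees 12 and 20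
come from a determinant and a wedge of two pairs. These degrees reach every admissible odd `n`
(`hasCovariantPair_of_odd`); nonvanishing is tracked at the point `(1, 0)`. -/

/-! ### Tensor-product operators on qubits -/

lemma tensorOp_apply {n : ℕ} (A : Fin n → Matrix (Fin 2) (Fin 2) ℂ) (v : Qubits n)
    (s : Fin n → Fin 2) :
    tensorOp A v s = ∑ t, (∏ i, A i (s i) (t i)) * v t := by
  simp [tensorOp, Matrix.toLpLin_apply, Matrix.mulVec, dotProduct]

lemma tensorOp_mul_apply {n : ℕ} (A B : Fin n → Matrix (Fin 2) (Fin 2) ℂ) (v : Qubits n) :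
    tensorOp (fun i => A i * B i) v = tensorOp A (tensorOp B v) := by
  ext s
  simp only [tensorOp_apply, Matrix.mul_apply, Finset.mul_sum]
  rw [Finset.sum_comm]
  refine Finset.sum_congr rfl fun t _ => ?_
  rw [Finset.prod_univ_sum, Finset.sum_mul]
  simp only [Fintype.piFinset_univ, Finset.prod_mul_distrib, mul_assoc]

lemma tensorOp_one {n : ℕ} (v : Qubits n) : tensorOp (fun _ => 1) v = v := by
  ext s
  rw [tensorOp_apply, Finset.sum_eq_single s]
  · simp
  · intro t _ hts
    obtain ⟨i, hi⟩ : ∃ i, t i ≠ s i := Function.ne_iff.1 hts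
    have h0 : (1 : Matrix (Fin 2) (Fin 2) ℂ) (s i) (t i) = 0 := Matrix.one_apply_ne hi.symm
    exact mul_eq_zero_of_left (Finset.prod_eq_zero (Finset.mem_univ i) h0) _
  · simp

lemma inner_tensorOp {n : ℕ} (A : Fin n → Matrix (Fin 2) (Fin 2) ℂ) (u v : Qubits n) :
    inner ℂ u (tensorOp A v) = inner ℂ (tensorOp (fun i => star (A i)) u) v := by
  have h : (Matrix.of fun s t : Fin n → Fin 2 => ∏ i, star (A i) (s i) (t i)) =
      (Matrix.of fun s t : Fin n → Fin 2 => ∏ i, A i (s i) (t i)).conjTranspose := by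
    ext s t
    simp [Matrix.conjTranspose_apply, Matrix.star_apply]
  rw [tensorOp, tensorOp, h, Matrix.toEuclideanLin_conjTranspose_eq_adjoint,
    LinearMap.adjoint_inner_left]

lemma inner_tensorOp_tensorOp {n : ℕ} {h : Matrix (Fin 2) (Fin 2) ℂ}
    (hh : h ∈ Matrix.unitaryGroup (Fin 2) ℂ) (u v : Qubits n) :
    inner ℂ (tensorOp (fun _ => h) u) (tensorOp (fun _ => h) v) = inner ℂ u v := by
  rw [inner_tensorOp, ← tensorOp_mul_apply, Matrix.mem_unitaryGroup_iff'.1 hh, tensorOp_one]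

/-! ### Dicke states and Wigner rotations -/

lemma hammingWeight_le {n : ℕ} (s : Fin n → Fin 2) : hammingWeight s ≤ n := by
  simpa [hammingWeight] using
    Finset.card_le_univ (Finset.univ.filter fun i => s i = 1)

lemma prod_eq_pow_hammingWeight {n : ℕ} {R : Type*} [CommMonoid R] (s : Fin n → Fin 2)
    (f : Fin 2 → R) :
    ∏ i, f (s i) = f 0 ^ (n - hammingWeight s) * f 1 ^ hammingWeight s := by
  have hc : (Finset.univ.filter fun i => ¬ s i = 1).card = n - hammingWeight s := by
    have := Finset.card_filter_add_card_filter_not (s := Finset.univ) (fun i : Fin n => s i = 1)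
    rw [Finset.card_univ, Fintype.card_fin] at this
    rw [hammingWeight]
    omega
  rw [← Finset.prod_filter_mul_prod_filter_not Finset.univ (fun i => s i = 1), mul_comm]
  congr 1
  · rw [← hc]
    refine Finset.prod_eq_pow_card fun i hi => ?_
    have := (Finset.mem_filter.1 hi).2
    rw [show s i = 0 by omega]
  · refine Finset.prod_eq_pow_card fun i hi => ?_
    rw [(Finset.mem_filter.1 hi).2]

lemma card_hammingWeight (n w : ℕ) :
    (Finset.univ.filter fun s : Fin n → Fin 2 => hammingWeight s = w).card = n.choose w := by
  rw [← Finset.card_fin n, ← Finset.card_powersetCard, Finset.card_fin]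
  refine Finset.card_bij' (fun s _ => Finset.univ.filter fun i => s i = 1)
    (fun T _ i => if i ∈ T then 1 else 0) ?_ ?_ ?_ ?_
  · intro s hs
    rw [Finset.mem_powersetCard]
    exact ⟨Finset.subset_univ _, (Finset.mem_filter.1 hs).2⟩
  · intro T hT
    rw [Finset.mem_filter]
    refine ⟨Finset.mem_univ _, ?_⟩
    rw [← (Finset.mem_powersetCard.1 hT).2, hammingWeight]
    congr 1
    ext i
    simp
  · intro s _
    ext i
    rcases Fin.exists_fin_two.1 ⟨s i, rfl⟩ with h | h <;> simp [h]
  · intro T _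
    ext i
    simp

lemma sum_hammingWeight {n : ℕ} {M : Type*} [AddCommMonoid M] (f : (Fin n → Fin 2) → M) :
    ∑ s, f s = ∑ w : Fin (n + 1), ∑ s with hammingWeight s = w, f s := by
  rw [← Finset.sum_fiberwise (g := fun s =>
    (⟨hammingWeight s, Nat.lt_succ_of_le (hammingWeight_le s)⟩ : Fin (n + 1)))]
  simp only [Fin.ext_iff]

/-- Expansion of a product of linear polynomials over bit strings. -/
lemma sum_prod_eq_coeff {n : ℕ} (g : Matrix (Fin 2) (Fin 2) ℂ) (s : Fin n → Fin 2) (w : ℕ) :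
    ∑ t with hammingWeight t = w, ∏ i, g (s i) (t i) =
      ((Polynomial.C (g 0 0) + Polynomial.C (g 0 1) * Polynomial.X) ^ (n - hammingWeight s) *
        (Polynomial.C (g 1 0) + Polynomial.C (g 1 1) * Polynomial.X) ^ hammingWeight s).coeff
          w := by
  have h := prod_eq_pow_hammingWeight s
    (fun a => Polynomial.C (g a 0) + Polynomial.C (g a 1) * Polynomial.X)
  rw [← h]
  have h2 : ∏ i, (Polynomial.C (g (s i) 0) + Polynomial.C (g (s i) 1) * Polynomial.X) =
      ∏ i, ∑ b : Fin 2, Polynomial.C (g (s i) b) * Polynomial.X ^ (b : ℕ) := by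
    simp [Fin.sum_univ_two]
  rw [h2, Finset.prod_univ_sum, Fintype.piFinset_univ, Polynomial.finsetSum_coeff,
    Finset.sum_filter]
  refine Finset.sum_congr rfl fun t _ => ?_
  have h3 := prod_eq_pow_hammingWeight t (fun b => (Polynomial.X : Polynomial ℂ) ^ (b : ℕ))
  simp only [Fin.val_zero, Fin.val_one, pow_zero, one_pow, one_mul, pow_one] at h3
  rw [Finset.prod_mul_distrib, h3, ← map_prod, Polynomial.coeff_C_mul, Polynomial.coeff_X_pow]
  simp [eq_comm]

lemma dickeMap_apply {n : ℕ} (v : SpinSpace n) (s : Fin n → Fin 2) (w : Fin (n + 1))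
    (hw : hammingWeight s = w) :
    dickeMap n v s = v w * ((1 / Real.sqrt (n.choose w : ℝ) : ℝ) : ℂ) := by
  have : dickeMap n v s = ∑ w : Fin (n + 1), v w * dickeState n (w : ℕ) s := by
    simp [dickeMap]
  rw [this, Finset.sum_eq_single w]
  · simp [dickeState, hw]
  · intro b _ hb
    have : ¬ hammingWeight s = b := fun h => hb (Fin.ext (h.symm.trans hw))
    simp [dickeState, this]
  · simp

/-- Each of the `n.choose w` strings of weight `w` contributes the same term, scaled by `1 /
n.choose w`. -/
lemma inner_dickeMap {n : ℕ} (u v : SpinSpace n) :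
    inner ℂ (dickeMap n u) (dickeMap n v) = inner ℂ u v := by
  rw [PiLp.inner_apply, PiLp.inner_apply, sum_hammingWeight]
  refine Finset.sum_congr rfl fun w _ => ?_
  have hpos : (0 : ℝ) < (n.choose w : ℝ) := by
    exact_mod_cast Nat.choose_pos (Nat.lt_succ_iff.1 w.2)
  have hc : ((1 / Real.sqrt (n.choose w : ℝ) : ℝ) : ℂ) * ((1 / Real.sqrt (n.choose w : ℝ) : ℝ) : ℂ)
      * (n.choose w : ℂ) = 1 := by
    norm_cast
    rw [div_mul_div_comm, Real.mul_self_sqrt hpos.le]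
    field_simp
  rw [Finset.sum_congr rfl (g := fun _ => inner ℂ (u w) (v w) *
    (((1 / Real.sqrt (n.choose w : ℝ) : ℝ) : ℂ) * ((1 / Real.sqrt (n.choose w : ℝ) : ℝ) : ℂ)))]
  · rw [Finset.sum_const, card_hammingWeight, nsmul_eq_mul]
    linear_combination (inner ℂ (u w) (v w)) * hc
  · intro s hs
    rw [dickeMap_apply u s w (Finset.mem_filter.1 hs).2,
      dickeMap_apply v s w (Finset.mem_filter.1 hs).2]
    simp only [RCLike.inner_apply, map_mul, Complex.conj_ofReal]
    ring

lemma dickeMap_injective (n : ℕ) : Function.Injective (dickeMap n) := by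
  rw [← LinearMap.ker_eq_bot, LinearMap.ker_eq_bot']
  intro v hv
  have := inner_dickeMap v v
  rw [hv, inner_zero_left] at this
  exact inner_self_eq_zero.1 this.symm

/-- The Dicke state map intertwines the Wigner rotation with the transversal gate. -/
lemma tensorOp_dickeMap {n : ℕ} (g : SU2) (v : SpinSpace n) :
    tensorOp (fun _ => g.1) (dickeMap n v) = dickeMap n (wignerD n g v) := by
  ext s
  obtain ⟨a, ha⟩ : ∃ a : Fin (n + 1), hammingWeight s = a :=
    ⟨⟨hammingWeight s, Nat.lt_succ_of_le (hammingWeight_le s)⟩, rfl⟩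
  rw [dickeMap_apply _ s a ha, tensorOp_apply, sum_hammingWeight]
  have hW : wignerD n g v a = ∑ w, wignerMatrix n g.1 a w * v w := by
    simp [wignerD, Matrix.toLpLin_apply, Matrix.mulVec, dotProduct]
  rw [hW, Finset.sum_mul]
  refine Finset.sum_congr rfl fun w _ => ?_
  have h1 : ∑ t with hammingWeight t = w, (∏ i, g.1 (s i) (t i)) * dickeMap n v t =
      (∑ t with hammingWeight t = w, ∏ i, g.1 (s i) (t i)) *
        (v w * ((1 / Real.sqrt (n.choose w : ℝ) : ℝ) : ℂ)) := by
    rw [Finset.sum_mul]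
    refine Finset.sum_congr rfl fun t ht => ?_
    rw [dickeMap_apply v t w (Finset.mem_filter.1 ht).2]
  rw [h1]
  set Q := ((Polynomial.C (g.1 0 0) + Polynomial.C (g.1 1 0) * Polynomial.X) ^ (n - (w : ℕ)) *
      (Polynomial.C (g.1 0 1) + Polynomial.C (g.1 1 1) * Polynomial.X) ^ (w : ℕ)).coeff (a : ℕ)
    with hQ
  set S := ∑ t with hammingWeight t = w, ∏ i, g.1 (s i) (t i) with hS
  -- Double counting over pairs of strings of weights `a` and `w`: the row sum depends only on the
  -- weight of the row and equals `S`; the column sum, computed with the transpose of `g`, is always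
  -- `Q`.
  have hdc : (n.choose a : ℂ) * S = (n.choose w : ℂ) * Q := by
    have e1 : ∑ s' with hammingWeight s' = (a : ℕ), ∑ t with hammingWeight t = (w : ℕ),
        ∏ i : Fin n, g.1 (s' i) (t i) = (n.choose a : ℂ) * S := by
      rw [Finset.sum_congr rfl (g := fun _ => S), Finset.sum_const, card_hammingWeight,
        nsmul_eq_mul]
      intro s' hs'
      rw [hS, sum_prod_eq_coeff, sum_prod_eq_coeff, ha, (Finset.mem_filter.1 hs').2]
    have e2 : ∑ t with hammingWeight t = (w : ℕ), ∑ s' with hammingWeight s' = (a : ℕ),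
        ∏ i : Fin n, g.1 (s' i) (t i) = (n.choose w : ℂ) * Q := by
      rw [Finset.sum_congr rfl (g := fun _ => Q), Finset.sum_const, card_hammingWeight,
        nsmul_eq_mul]
      intro t ht
      have := sum_prod_eq_coeff g.1.transpose t a
      simp only [Matrix.transpose_apply, (Finset.mem_filter.1 ht).2] at this
      rw [this, hQ]
    rw [← e1, ← e2, Finset.sum_comm]
  have hWm : wignerMatrix n g.1 a w = ((Real.sqrt (((n - (a : ℕ)).factorial * (a : ℕ).factorial : ℕ) : ℝ) /
      Real.sqrt (((n - (w : ℕ)).factorial * (w : ℕ).factorial : ℕ) : ℝ) : ℝ) : ℂ) * Q := rfl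
  -- The factorial and binomial normalizations multiply to `√(n!)`, whatever the weight; this links
  -- those at `a` and at `w`.
  have key : ∀ b : Fin (n + 1), ∃ f c m : ℝ, 0 < f ∧ 0 < c ∧ f * c = m ∧ m = Real.sqrt n.factorial ∧
      Real.sqrt (((n - (b : ℕ)).factorial * (b : ℕ).factorial : ℕ) : ℝ) = f ∧
      Real.sqrt (n.choose b : ℝ) = c ∧ (n.choose b : ℝ) = c ^ 2 := by
    intro b
    have hb := Nat.choose_mul_factorial_mul_factorial (Nat.lt_succ_iff.1 b.2)
    have hcp : (0 : ℝ) < (n.choose b : ℝ) := by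
      exact_mod_cast Nat.choose_pos (Nat.lt_succ_iff.1 b.2)
    refine ⟨_, _, _, Real.sqrt_pos.2 (by positivity), Real.sqrt_pos.2 hcp, ?_, rfl, rfl, rfl,
      (Real.sq_sqrt hcp.le).symm⟩
    rw [← Real.sqrt_mul (by positivity)]
    congr 1
    rw [← hb]
    push_cast
    ring
  obtain ⟨f, c, m, hf, hc, hfc, hm, ef, ec, ec2⟩ := key a
  obtain ⟨f', c', m', hf', hc', hfc', hm', ef', ec', ec2'⟩ := key w
  rw [hWm, ef, ef', ec, ec']
  have ec2c : (n.choose a : ℂ) = (c : ℂ) ^ 2 := by exact_mod_cast ec2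
  have ec2c' : (n.choose w : ℂ) = (c' : ℂ) ^ 2 := by exact_mod_cast ec2'
  have hff : (f : ℂ) * c = f' * c' := by
    exact_mod_cast hfc.trans (hm.trans (hm'.symm.trans hfc'.symm))
  rw [ec2c, ec2c'] at hdc
  have hcC : (c : ℂ) ≠ 0 := by exact_mod_cast hc.ne'
  have hcC' : (c' : ℂ) ≠ 0 := by exact_mod_cast hc'.ne'
  have hfC' : (f' : ℂ) ≠ 0 := by exact_mod_cast hf'.ne'
  have hfC : (f : ℂ) ≠ 0 := by exact_mod_cast hf.ne'
  push_cast
  field_simp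
  have : (c : ℂ) * (S * c * f') = c * (c' * f * Q) := by
    linear_combination f' * hdc - c' * Q * hff
  have h4 := mul_left_cancel₀ hcC this
  linear_combination v w * h4

/-- Multiplicativity is evident for tensor powers and is pulled back along the injective Dicke map;
no identity between polynomial coefficients is needed. -/
lemma wignerD_mul {n : ℕ} (g h : SU2) (v : SpinSpace n) :
    wignerD n (g * h) v = wignerD n g (wignerD n h v) := by
  apply dickeMap_injective
  rw [← tensorOp_dickeMap, ← tensorOp_dickeMap, ← tensorOp_dickeMap, ← tensorOp_mul_apply]
  rfl

lemma wignerD_one {n : ℕ} (v : SpinSpace n) : wignerD n 1 v = v := by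
  apply dickeMap_injective
  rw [← tensorOp_dickeMap]
  exact tensorOp_one _

lemma inner_wignerD {n : ℕ} (g : SU2) (u v : SpinSpace n) :
    inner ℂ (wignerD n g u) (wignerD n g v) = inner ℂ u v := by
  rw [← inner_dickeMap, ← tensorOp_dickeMap, ← tensorOp_dickeMap,
    inner_tensorOp_tensorOp (Matrix.mem_specialUnitaryGroup_iff.1 g.2).1, inner_dickeMap]

/-! ### Binary forms -/

/-- The monomial `x ^ (n - w) * y ^ w` as a function of `x` and `y`. -/
def monomialForm (n : ℕ) (w : Fin (n + 1)) : ℂ → ℂ → ℂ := fun x y => x ^ (n - (w : ℕ)) * y ^ (w : ℕ)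

/-- Binary forms of degree `n` with real coefficients. -/
noncomputable def realForms (n : ℕ) : Submodule ℝ (ℂ → ℂ → ℂ) :=
  Submodule.span ℝ (Set.range (monomialForm n))

lemma monomial_mem_realForms {n a b : ℕ} (h : a + b = n) :
    (fun x y : ℂ => x ^ a * y ^ b) ∈ realForms n := by
  refine Submodule.subset_span ⟨⟨b, by omega⟩, ?_⟩
  have : n - b = a := by omega
  funext x y
  simp only [monomialForm, this]

lemma mul_mem_realForms {m n : ℕ} {P Q : ℂ → ℂ → ℂ} (hP : P ∈ realForms m)
    (hQ : Q ∈ realForms n) : P * Q ∈ realForms (m + n) := by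
  have h := Submodule.mul_mem_mul hP hQ
  rw [realForms, realForms, Submodule.span_mul_span] at h
  refine Submodule.span_le.2 ?_ h
  rintro _ ⟨_, ⟨v, rfl⟩, _, ⟨w, rfl⟩, rfl⟩
  have : monomialForm m v * monomialForm n w =
      fun x y : ℂ => x ^ (m - (v : ℕ) + (n - (w : ℕ))) * y ^ ((v : ℕ) + (w : ℕ)) := by
    funext x y
    simp only [Pi.mul_apply, monomialForm, pow_add]
    ring
  simp only [this]
  exact monomial_mem_realForms (by omega)

lemma exists_coeff_of_mem_realForms {n : ℕ} {P : ℂ → ℂ → ℂ} (hP : P ∈ realForms n) :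
    ∃ c : Fin (n + 1) → ℝ, ∀ x y, P x y = ∑ w, (c w : ℂ) * (x ^ (n - (w : ℕ)) * y ^ (w : ℕ)) := by
  obtain ⟨c, rfl⟩ := (Submodule.mem_span_range_iff_exists_fun ℝ).1 hP
  exact ⟨c, fun x y => by simp [monomialForm, Finset.sum_apply]⟩

/-- The spin state of a binary form with given coefficients. -/
noncomputable def spinState {n : ℕ} (c : Fin (n + 1) → ℂ) : SpinSpace n :=
  WithLp.toLp 2 fun w =>
    c w * (Real.sqrt (((n - (w : ℕ)).factorial * (w : ℕ).factorial : ℕ) : ℝ) : ℂ)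

lemma sqrt_factorial_ne_zero (a b : ℕ) :
    (Real.sqrt ((a.factorial * b.factorial : ℕ) : ℝ) : ℂ) ≠ 0 := by
  have : (0 : ℝ) < ((a.factorial * b.factorial : ℕ) : ℝ) := by
    exact_mod_cast Nat.mul_pos a.factorial_pos b.factorial_pos
  exact_mod_cast (Real.sqrt_pos.2 this).ne'

/-- The Wigner rotation acts on spin states by linear substitution in binary forms. -/
lemma wignerD_spinState {n : ℕ} (g : SU2) (c d : Fin (n + 1) → ℂ)
    (h : ∀ x y : ℂ, ∑ w, c w * ((g.1 0 0 * x + g.1 1 0 * y) ^ (n - (w : ℕ)) *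
      (g.1 0 1 * x + g.1 1 1 * y) ^ (w : ℕ)) =
        ∑ w, d w * (x ^ (n - (w : ℕ)) * y ^ (w : ℕ))) :
    wignerD n g (spinState c) = spinState d := by
  have hp : ∑ w : Fin (n + 1), Polynomial.C (c w) *
      ((Polynomial.C (g.1 0 0) + Polynomial.C (g.1 1 0) * Polynomial.X) ^ (n - (w : ℕ)) *
      (Polynomial.C (g.1 0 1) + Polynomial.C (g.1 1 1) * Polynomial.X) ^ (w : ℕ)) =
      ∑ w : Fin (n + 1), Polynomial.C (d w) * Polynomial.X ^ (w : ℕ) := by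
    -- Setting `x = 1` dehomogenizes; polynomials that agree at every complex `y` are equal.
    refine Polynomial.funext fun y => ?_
    simpa [Polynomial.eval_finsetSum] using h 1 y
  ext v
  have hc := congrArg (fun p => Polynomial.coeff p (v : ℕ)) hp
  simp only [Polynomial.finsetSum_coeff, Polynomial.coeff_C_mul, Polynomial.coeff_X_pow] at hc
  have hd : ∑ w : Fin (n + 1), d w * (if (v : ℕ) = w then 1 else 0) = d v := by
    simp [← Fin.ext_iff]
  rw [hd] at hc
  have hW : wignerD n g (spinState c) v = ∑ w, wignerMatrix n g.1 v w * spinState c w := by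
    simp [wignerD, Matrix.toLpLin_apply, Matrix.mulVec, dotProduct]
  rw [hW]
  simp only [spinState, ← hc, Finset.sum_mul]
  refine Finset.sum_congr rfl fun w _ => ?_
  have h0 := sqrt_factorial_ne_zero (n - (w : ℕ)) w
  simp only [wignerMatrix, Matrix.of_apply, Complex.ofReal_div]
  field_simp

/-- The pair of binary forms `P` transforms by the matrix `r` under the substitution `g`. -/
def IsCovariant (g r : Matrix (Fin 2) (Fin 2) ℂ) (P : Fin 2 → ℂ → ℂ → ℂ) : Prop :=
  ∀ k x y, P k (g 0 0 * x + g 1 0 * y) (g 0 1 * x + g 1 1 * y) = ∑ l, r l k * P l x y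

/-- The pairs `(g, r)` such that `u` transforms by the matrix `r` under the rotation `g`. -/
def covarianceGroup {n : ℕ} (u : Fin 2 → SpinSpace n) : Subgroup (SU2 × SU2) where
  carrier := {p | ∀ k, wignerD n p.1 (u k) = ∑ l, p.2.1 l k • u l}
  one_mem' k := by
    fin_cases k <;> simp [wignerD_one, Fin.sum_univ_two]
  mul_mem' := by
    intro p q hp hq k
    simp only [Prod.fst_mul, Prod.snd_mul, wignerD_mul]
    rw [hq k, map_sum]
    simp only [map_smul]
    simp only [hp _, Submonoid.coe_mul, Matrix.mul_apply, Fin.sum_univ_two, smul_add, smul_smul,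
      add_smul]
    module
  inv_mem' := by
    intro p hp k
    have h1 : ∀ v, wignerD n p.1⁻¹ (wignerD n p.1 v) = v := fun v => by
      rw [← wignerD_mul, inv_mul_cancel, wignerD_one]
    -- Applying `D(g⁻¹)` to the covariance relation gives a linear system for the vectors `D(g⁻¹) u
    -- m`, solved below by the inverse matrix.
    have h2 : ∀ l, ∑ m, p.2.1 m l • wignerD n p.1⁻¹ (u m) = u l := fun l => by
      rw [← h1 (u l), hp l, map_sum]
      simp only [map_smul]
    have h3 : p.2.1 * (p.2⁻¹).1 = 1 := by
      have := congrArg Subtype.val (mul_inv_cancel p.2)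
      exact this
    have h4 := fun i j => congrFun (congrFun h3 i) j
    simp only [Matrix.mul_apply] at h4
    change wignerD n p.1⁻¹ (u k) = ∑ l, (p.2⁻¹).1 l k • u l
    have h5 : ∑ l, (p.2⁻¹).1 l k • u l =
        ∑ l, (p.2⁻¹).1 l k • ∑ m, p.2.1 m l • wignerD n p.1⁻¹ (u m) :=
      Finset.sum_congr rfl fun l _ => by rw [h2 l]
    rw [h5]
    simp only [Finset.smul_sum, smul_smul]
    rw [Finset.sum_comm]
    simp only [← Finset.sum_smul]
    simp only [mul_comm _ (p.2.1 _ _), h4]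
    simp [Matrix.one_apply]

lemma wignerD_covariant {n : ℕ} {g r : SU2} {P : Fin 2 → ℂ → ℂ → ℂ}
    {c : Fin 2 → Fin (n + 1) → ℂ} (h : IsCovariant g.1 r.1 P)
    (hc : ∀ k x y, P k x y = ∑ w, c k w * (x ^ (n - (w : ℕ)) * y ^ (w : ℕ))) (k : Fin 2) :
    wignerD n g (spinState (c k)) = ∑ l, r.1 l k • spinState (c l) := by
  have h1 : ∑ l, r.1 l k • spinState (c l) = spinState fun w => ∑ l, r.1 l k * c l w := by
    ext w
    simp only [spinState, Fin.sum_univ_two, PiLp.add_apply, PiLp.smul_apply, smul_eq_mul]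
    ring
  rw [h1]
  refine wignerD_spinState g _ _ fun x y => ?_
  rw [← hc, h]
  simp only [hc, Finset.mul_sum, Finset.sum_mul]
  rw [Finset.sum_comm]
  simp only [mul_assoc]

/-! ### The graph of Galois conjugation and orthonormal covariant pairs -/

/-- The Galois conjugate of the gate `Φ`. -/
noncomputable def gatePhiGalois : SU2 :=
  su2Mk (((-Real.goldenRatio⁻¹ / 2 : ℝ) : ℂ) + Complex.I * ((-Real.goldenRatio / 2 : ℝ) : ℂ))
    (1 / 2) (by
    have h5 : √5 * √5 = (5 : ℝ) := Real.mul_self_sqrt (by norm_num)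
    rw [Real.inv_goldenRatio, Real.goldenRatio, Real.goldenConj]
    apply Complex.ext <;> simp <;> nlinarith)

/-- The graph of the Galois conjugation `√5 ↦ -√5` on the generators of the binary icosahedral
group. -/
def galoisGenerators : Set (SU2 × SU2) :=
  {(gateX, gateX), (gateZ, gateZ), (gateF, gateF), (gatePhi, gatePhiGalois)}

lemma orthonormal_of_norm_inner {n : ℕ} {U : Fin 2 → SpinSpace n} (h01 : inner ℂ (U 0) (U 1) = 0)
    (hn : ‖U 0‖ = ‖U 1‖) (h0 : U 0 ≠ 0) :
    Orthonormal ℂ fun k => ((‖U 0‖⁻¹ : ℝ) : ℂ) • U k := by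
  have h0' : ‖U 0‖ ≠ 0 := norm_ne_zero_iff.2 h0
  have h10 : inner ℂ (U 1) (U 0) = 0 := by rw [← inner_conj_symm, h01, map_zero]
  constructor
  · intro k
    fin_cases k
    · simp [norm_smul, h0']
    · simp [norm_smul, ← hn, h0']
  · intro k l hkl
    fin_cases k <;> fin_cases l <;> simp_all [inner_smul_left, inner_smul_right]

/-- Covariant pairs of real binary forms yield real orthonormal pairs of spin states. -/
lemma exists_orthonormal_of_covariant {n : ℕ} {P : Fin 2 → ℂ → ℂ → ℂ}
    (hP : ∀ k, P k ∈ realForms n) (hcov : ∀ p ∈ galoisGenerators, IsCovariant p.1.1 p.2.1 P)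
    (hne : ∃ k x y, P k x y ≠ 0) :
    ∃ u : Fin 2 → SpinSpace n, Orthonormal ℂ u ∧ (∀ k w, (u k w).im = 0) ∧
      Subgroup.closure galoisGenerators ≤ covarianceGroup u := by
  choose c hc using fun k => exists_coeff_of_mem_realForms (hP k)
  set U : Fin 2 → SpinSpace n := fun k => spinState fun w => (c k w : ℂ) with hU
  have hUcov : ∀ p ∈ galoisGenerators, ∀ k, wignerD n p.1 (U k) = ∑ l, p.2.1 l k • U l :=
    fun p hp k => wignerD_covariant (hcov p hp) hc k
  have hX := hUcov (gateX, gateX) (by simp [galoisGenerators])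
  have hZ := hUcov (gateZ, gateZ) (by simp [galoisGenerators])
  have hX0 : wignerD n gateX (U 0) = (-Complex.I) • U 1 := by
    rw [hX 0]; simp [gateX, su2Mk, Fin.sum_univ_two]
  have hZ0 : wignerD n gateZ (U 0) = (-Complex.I) • U 0 := by
    rw [hZ 0]; simp [gateZ, su2Mk, Fin.sum_univ_two]
  have hZ1 : wignerD n gateZ (U 1) = Complex.I • U 1 := by
    rw [hZ 1]; simp [gateZ, su2Mk, Fin.sum_univ_two]
  -- Eigenvectors of the unitary `D(Z)` for the distinct eigenvalues `-i` and `i`.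
  have h01 : inner ℂ (U 0) (U 1) = 0 := by
    have h := inner_wignerD gateZ (U 0) (U 1)
    rw [hZ0, hZ1, inner_smul_left, inner_smul_right, ← mul_assoc] at h
    have h1 : (starRingEnd ℂ) (-Complex.I) * Complex.I = -1 := by simp
    rw [h1] at h
    linear_combination (-1 / 2 : ℂ) * h
  -- The unitary `D(X)` sends `U 0` to a unit multiple of `U 1`.
  have hn : ‖U 0‖ = ‖U 1‖ := by
    have h := inner_wignerD gateX (U 0) (U 0)
    have h1 : (starRingEnd ℂ) (-Complex.I) * -Complex.I = 1 := by simp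
    rw [hX0, inner_smul_left, inner_smul_right, ← mul_assoc, h1, one_mul,
      inner_self_eq_norm_sq_to_K, inner_self_eq_norm_sq_to_K] at h
    have h2 : ‖U 1‖ ^ 2 = ‖U 0‖ ^ 2 := by exact_mod_cast h
    exact ((sq_eq_sq₀ (norm_nonneg _) (norm_nonneg _)).1 h2).symm
  have h0 : U 0 ≠ 0 := by
    intro h0
    have h1 : U 1 = 0 := by rw [← norm_eq_zero, ← hn, h0, norm_zero]
    obtain ⟨k, x, y, hk⟩ := hne
    apply hk
    have hUk : U k = 0 := by fin_cases k; exacts [h0, h1]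
    rw [hc]
    refine Finset.sum_eq_zero fun w _ => ?_
    have hw : U k w = 0 := by rw [hUk]; rfl
    have : (c k w : ℂ) = 0 := (mul_eq_zero.1 hw).resolve_right (sqrt_factorial_ne_zero _ _)
    rw [this, zero_mul]
  refine ⟨_, orthonormal_of_norm_inner h01 hn h0, ?_, ?_⟩
  · intro k w
    simp only [PiLp.smul_apply, smul_eq_mul, hU, spinState]
    norm_cast
  · rw [Subgroup.closure_le]
    intro p hp k
    simp only [map_smul, hUcov p hp k, Finset.smul_sum]
    exact Finset.sum_congr rfl fun l _ => smul_comm _ _ _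

/-! ### Equivariant matrix-valued maps on Pauli matrices -/

lemma sqrt_five_coe_sq : ((√5 : ℝ) : ℂ) ^ 2 = 5 := by
  exact_mod_cast Real.sq_sqrt (show (0 : ℝ) ≤ 5 by norm_num)

/-- Rationalizes the `φ⁻¹` in the gates, so that their entries become visible elements of `ℚ(√5,
i)`. -/
lemma inv_one_add_sqrt_five_coe : (1 + ((√5 : ℝ) : ℂ))⁻¹ = ((√5 : ℝ) - 1) / 4 := by
  refine inv_eq_of_mul_eq_one_right ?_
  linear_combination sqrt_five_coe_sq / 4

lemma su2Mk_coe {a b : ℂ} (h : a * star a + b * star b = 1) :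
    (su2Mk a b h).1 = !![a, b; -star b, star a] := rfl

lemma gateF_coe : gateF.1 = !![(1 - Complex.I) / 2, (-1 - Complex.I) / 2;
    (1 - Complex.I) / 2, (1 + Complex.I) / 2] := by
  rw [gateF, su2Mk_coe]
  ext i j
  fin_cases i <;> fin_cases j <;> simp
  ring

lemma gatePhi_coe : gatePhi.1 =
    !![((1 + (√5 : ℝ)) + Complex.I * ((√5 : ℝ) - 1)) / 4, 1 / 2;
      -1 / 2, ((1 + (√5 : ℝ)) - Complex.I * ((√5 : ℝ) - 1)) / 4] := by
  rw [gatePhi, su2Mk_coe]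
  ext i j
  fin_cases i <;> fin_cases j <;>
    simp [div_eq_mul_inv, inv_one_add_sqrt_five_coe] <;> ring

lemma gatePhiGalois_coe : gatePhiGalois.1 =
    !![((1 - (√5 : ℝ)) - Complex.I * ((√5 : ℝ) + 1)) / 4, 1 / 2;
      -1 / 2, ((1 - (√5 : ℝ)) + Complex.I * ((√5 : ℝ) + 1)) / 4] := by
  rw [gatePhiGalois, su2Mk_coe]
  ext i j
  fin_cases i <;> fin_cases j <;>
    simp [div_eq_mul_inv, inv_one_add_sqrt_five_coe] <;> ring

lemma gatePhiStar_coe : gatePhiStar.1 =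
    !![((1 - (√5 : ℝ)) + Complex.I * ((√5 : ℝ) + 1)) / 4, 1 / 2;
      -1 / 2, ((1 - (√5 : ℝ)) - Complex.I * ((√5 : ℝ) + 1)) / 4] := by
  rw [gatePhiStar, su2Mk_coe]
  ext i j
  fin_cases i <;> fin_cases j <;>
    simp [div_eq_mul_inv, inv_one_add_sqrt_five_coe] <;> ring

lemma gateX_coe : gateX.1 = (-Complex.I) • pauli 1 := by
  ext i j
  fin_cases i <;> fin_cases j <;> simp [gateX, su2Mk, pauli]

lemma gateZ_coe : gateZ.1 = (-Complex.I) • pauli 3 := by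
  ext i j
  fin_cases i <;> fin_cases j <;> simp [gateZ, su2Mk, pauli]

/-- The action on the Pauli matrices by conjugation, written as `g * A = A' * g` to avoid inverses:
`X` and `Z` act by signs, `F` by a 3-cycle, and `Φ` by a rotation with coefficients in `ℚ(√5)`. -/
lemma gateX_mul_pauli : gateX.1 * pauli 1 = pauli 1 * gateX.1 ∧
    gateX.1 * pauli 2 = -pauli 2 * gateX.1 ∧ gateX.1 * pauli 3 = -pauli 3 * gateX.1 := by
  refine ⟨?_, ?_, ?_⟩ <;> ext i j <;> fin_cases i <;> fin_cases j <;>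
    simp [gateX_coe, pauli, Matrix.mul_apply, Fin.sum_univ_two]

lemma gateZ_mul_pauli : gateZ.1 * pauli 1 = -pauli 1 * gateZ.1 ∧
    gateZ.1 * pauli 2 = -pauli 2 * gateZ.1 ∧ gateZ.1 * pauli 3 = pauli 3 * gateZ.1 := by
  refine ⟨?_, ?_, ?_⟩ <;> ext i j <;> fin_cases i <;> fin_cases j <;>
    simp [gateZ_coe, pauli, Matrix.mul_apply, Fin.sum_univ_two]

lemma gateF_mul_pauli : gateF.1 * pauli 1 = pauli 2 * gateF.1 ∧
    gateF.1 * pauli 2 = pauli 3 * gateF.1 ∧ gateF.1 * pauli 3 = pauli 1 * gateF.1 := by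
  have hI := Complex.I_sq
  refine ⟨?_, ?_, ?_⟩ <;> ext i j <;> fin_cases i <;> fin_cases j <;>
    simp [gateF_coe, pauli, Matrix.mul_apply, Fin.sum_univ_two] <;> grind

lemma gatePhi_mul_pauli (s : ℂ) (hs : s = (√5 : ℝ)) :
    gatePhi.1 * pauli 1 =
      (((s - 1) / 4) • pauli 1 - (1 / 2 : ℂ) • pauli 2 + ((s + 1) / 4) • pauli 3) * gatePhi.1 ∧
    gatePhi.1 * pauli 2 =
      ((1 / 2 : ℂ) • pauli 1 + ((s + 1) / 4) • pauli 2 + ((s - 1) / 4) • pauli 3) *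
        gatePhi.1 := by
  have hI := Complex.I_sq
  have h2 := sqrt_five_coe_sq
  rw [← hs] at h2
  rw [gatePhi_coe, ← hs]
  clear hs
  refine ⟨?_, ?_⟩ <;> ext i j <;> fin_cases i <;> fin_cases j <;>
    simp [pauli, Matrix.mul_apply, Fin.sum_univ_two] <;> grind

lemma gatePhiGalois_mul_pauli (s : ℂ) (hs : s = (√5 : ℝ)) :
    gatePhiGalois.1 * pauli 1 =
      ((-(s + 1) / 4) • pauli 1 - (1 / 2 : ℂ) • pauli 2 + ((1 - s) / 4) • pauli 3) *
        gatePhiGalois.1 ∧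
    gatePhiGalois.1 * pauli 3 =
      (((s - 1) / 4) • pauli 1 - ((s + 1) / 4) • pauli 2 + (1 / 2 : ℂ) • pauli 3) *
        gatePhiGalois.1 := by
  have hI := Complex.I_sq
  have h2 := sqrt_five_coe_sq
  rw [← hs] at h2
  rw [gatePhiGalois_coe, ← hs]
  clear hs
  refine ⟨?_, ?_⟩ <;> ext i j <;> fin_cases i <;> fin_cases j <;>
    simp [pauli, Matrix.mul_apply, Fin.sum_univ_two] <;> grind

lemma SU2.mul_right_cancel_coe (g : SU2) {A B : Matrix (Fin 2) (Fin 2) ℂ}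
    (h : A * g.1 = B * g.1) : A = B := by
  have hg : g.1 * (g⁻¹).1 = 1 := congrArg Subtype.val (mul_inv_cancel g)
  have := congrArg (· * (g⁻¹).1) h
  simpa only [mul_assoc, hg, mul_one] using this

section PauliSigns

variable {M : Matrix (Fin 2) (Fin 2) ℂ}

/-- Conjugation by `X` and `Z` has four distinct sign patterns on `1, X, Y, Z`, so each joint
eigenspace is a line. This and the next three lemmas treat the four patterns. -/
lemma exists_eq_smul_one (hX : gateX.1 * M = M * gateX.1) (hZ : gateZ.1 * M = M * gateZ.1) :
    ∃ c : ℂ, M = c • 1 := by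
  have h1 := congrFun (congrFun hX 0) 1
  have h2 := congrFun (congrFun hZ 0) 1
  have h3 := congrFun (congrFun hZ 1) 0
  simp [gateX_coe, gateZ_coe, pauli, Matrix.mul_apply, Fin.sum_univ_two] at h1 h2 h3
  refine ⟨M 0 0, ?_⟩
  ext i j
  fin_cases i <;> fin_cases j <;> simp <;> grind [Complex.I_ne_zero]

lemma exists_eq_smul_pauli_one (hX : gateX.1 * M = M * gateX.1)
    (hZ : gateZ.1 * M = -M * gateZ.1) : ∃ c : ℂ, M = c • pauli 1 := by
  have h1 := congrFun (congrFun hX 0) 0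
  have h2 := congrFun (congrFun hZ 0) 0
  have h3 := congrFun (congrFun hZ 1) 1
  simp [gateX_coe, gateZ_coe, pauli, Matrix.mul_apply, Fin.sum_univ_two] at h1 h2 h3
  refine ⟨M 0 1, ?_⟩
  ext i j
  fin_cases i <;> fin_cases j <;> simp [pauli] <;> grind [Complex.I_ne_zero]

lemma exists_eq_smul_pauli_two (hX : gateX.1 * M = -M * gateX.1)
    (hZ : gateZ.1 * M = -M * gateZ.1) : ∃ c : ℂ, M = c • pauli 2 := by
  have h1 := congrFun (congrFun hX 0) 0
  have h2 := congrFun (congrFun hZ 0) 0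
  have h3 := congrFun (congrFun hZ 1) 1
  simp [gateX_coe, gateZ_coe, pauli, Matrix.mul_apply, Fin.sum_univ_two] at h1 h2 h3
  have hI := Complex.I_sq
  refine ⟨Complex.I * M 0 1, ?_⟩
  ext i j
  fin_cases i <;> fin_cases j <;> simp [pauli] <;> grind [Complex.I_ne_zero]

lemma exists_eq_smul_pauli_three (hX : gateX.1 * M = -M * gateX.1)
    (hZ : gateZ.1 * M = M * gateZ.1) : ∃ c : ℂ, M = c • pauli 3 := by
  have h1 := congrFun (congrFun hX 0) 1
  have h2 := congrFun (congrFun hZ 0) 1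
  have h3 := congrFun (congrFun hZ 1) 0
  simp [gateX_coe, gateZ_coe, pauli, Matrix.mul_apply, Fin.sum_univ_two] at h1 h2 h3
  refine ⟨M 0 0, ?_⟩
  ext i j
  fin_cases i <;> fin_cases j <;> simp [pauli] <;> grind [Complex.I_ne_zero]

end PauliSigns

lemma pauli_ne_zero (a : Fin 4) : pauli a ≠ 0 := by
  intro h
  have h0 := congrFun (congrFun h 0) 0
  have h1 := congrFun (congrFun h 0) 1
  fin_cases a <;> simp [pauli] at h0 h1

/-- A matrix-valued linear map which intertwines conjugation by each generator `g` with
conjugation by its Galois conjugate vanishes on the Pauli matrices. -/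
lemma equivariant_apply_pauli
    (M : Matrix (Fin 2) (Fin 2) ℂ →ₗ[ℂ] Matrix (Fin 2) (Fin 2) ℂ)
    (hM : ∀ p ∈ galoisGenerators, ∀ A A', p.1.1 * A = A' * p.1.1 →
      p.2.1 * M A = M A' * p.2.1) :
    M (pauli 1) = 0 ∧ M (pauli 2) = 0 ∧ M (pauli 3) = 0 := by
  have hX := hM (gateX, gateX) (by simp [galoisGenerators])
  have hZ := hM (gateZ, gateZ) (by simp [galoisGenerators])
  have hF := hM (gateF, gateF) (by simp [galoisGenerators])
  have hP := hM (gatePhi, gatePhiGalois) (by simp [galoisGenerators])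
  obtain ⟨X1, X2, X3⟩ := gateX_mul_pauli
  obtain ⟨Z1, Z2, Z3⟩ := gateZ_mul_pauli
  obtain ⟨F1, F2, F3⟩ := gateF_mul_pauli
  obtain ⟨P1, P2⟩ := gatePhi_mul_pauli _ rfl
  obtain ⟨G1, G3⟩ := gatePhiGalois_mul_pauli _ rfl
  have x1 := hX _ _ X1
  have x2 := hX _ _ X2
  have x3 := hX _ _ X3
  have z1 := hZ _ _ Z1
  have z2 := hZ _ _ Z2
  have z3 := hZ _ _ Z3
  have f1 := hF _ _ F1
  have f2 := hF _ _ F2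
  have f3 := hF _ _ F3
  have p1 := hP _ _ P1
  simp only [map_neg, map_add, map_sub, map_smul] at x1 x2 x3 z1 z2 z3 f1 f2 f3 p1
  -- The signs make `M` diagonal on the Pauli matrices; the 3-cycle `F` then makes its three
  -- eigenvalues equal.
  obtain ⟨c₁, h1⟩ := exists_eq_smul_pauli_one x1 z1
  obtain ⟨c₂, h2⟩ := exists_eq_smul_pauli_two x2 z2
  obtain ⟨c₃, h3⟩ := exists_eq_smul_pauli_three x3 z3
  rw [h1, h2, Matrix.mul_smul, F1, ← Matrix.smul_mul] at f1
  have e12 : c₁ = c₂ := smul_left_injective ℂ (pauli_ne_zero 2) (SU2.mul_right_cancel_coe _ f1)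
  rw [h2, h3, Matrix.mul_smul, F2, ← Matrix.smul_mul] at f2
  have e23 : c₂ = c₃ := smul_left_injective ℂ (pauli_ne_zero 3) (SU2.mul_right_cancel_coe _ f2)
  rw [h1, h2, h3, Matrix.mul_smul, G1, ← Matrix.smul_mul] at p1
  have p2 := congrFun (congrFun (SU2.mul_right_cancel_coe _ p1) 0) 1
  have p3 := congrFun (congrFun (SU2.mul_right_cancel_coe _ p1) 1) 0
  simp [pauli] at p2 p3
  have hs := sqrt_five_coe_sq
  have hc : c₁ = 0 := by
    subst e12 e23
    -- Adding the off-diagonal entries isolates the coefficient of `pauli 1`, in which the rotations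
    -- of `Φ` and of its conjugate differ by `√5 / 2`.
    have : c₁ * (√5 : ℝ) = 0 := by linear_combination -p2 - p3
    refine (mul_eq_zero.1 this).resolve_right fun h => ?_
    grind
  subst e12 e23
  simp [h1, h2, h3, hc]

/-- A matrix-valued bilinear map which intertwines conjugation by each generator `g` with
conjugation by its Galois conjugate takes scalar values on pairs of Pauli matrices. -/
lemma equivariant_apply_pauli_pauli
    (M : Matrix (Fin 2) (Fin 2) ℂ →ₗ[ℂ] Matrix (Fin 2) (Fin 2) ℂ →ₗ[ℂ] Matrix (Fin 2) (Fin 2) ℂ)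
    (hM : ∀ p ∈ galoisGenerators, ∀ A A' B B', p.1.1 * A = A' * p.1.1 → p.1.1 * B = B' * p.1.1 →
      p.2.1 * M A B = M A' B' * p.2.1) (a b : Fin 4) :
    ∃ c : ℂ, M (pauli a) (pauli b) = c • 1 := by
  have one_comm : ∀ g : Matrix (Fin 2) (Fin 2) ℂ, g * pauli 0 = pauli 0 * g := fun g => by
    simp [pauli]
  -- With the identity in one slot the map is linear and equivariant in the other, so the one-site
  -- result applies.
  obtain ⟨l1, l2, l3⟩ := equivariant_apply_pauli (M.flip (pauli 0))
    fun p hp A A' hA => hM p hp _ _ _ _ hA (one_comm _)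
  obtain ⟨r1, r2, r3⟩ := equivariant_apply_pauli (M (pauli 0))
    fun p hp A A' hA => hM p hp _ _ _ _ (one_comm _) hA
  have hX := hM (gateX, gateX) (by simp [galoisGenerators])
  have hZ := hM (gateZ, gateZ) (by simp [galoisGenerators])
  have hF := hM (gateF, gateF) (by simp [galoisGenerators])
  have hP := hM (gatePhi, gatePhiGalois) (by simp [galoisGenerators])
  obtain ⟨X1, X2, X3⟩ := gateX_mul_pauli
  obtain ⟨Z1, Z2, Z3⟩ := gateZ_mul_pauli
  obtain ⟨F1, F2, F3⟩ := gateF_mul_pauli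
  obtain ⟨P1, P2⟩ := gatePhi_mul_pauli _ rfl
  obtain ⟨G1, G3⟩ := gatePhiGalois_mul_pauli _ rfl
  obtain ⟨d₀, h00⟩ := exists_eq_smul_one (hX _ _ _ _ (one_comm _) (one_comm _))
    (hZ _ _ _ _ (one_comm _) (one_comm _))
  -- By signs, equal Pauli matrices give a scalar and two different ones a multiple of the third.
  -- `F` then leaves one constant for the cyclic order and one for the reverse order.
  obtain ⟨d₁, h11⟩ := exists_eq_smul_one (M := M (pauli 1) (pauli 1))
    (by simpa using hX _ _ _ _ X1 X1) (by simpa using hZ _ _ _ _ Z1 Z1)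
  obtain ⟨d₂, h22⟩ := exists_eq_smul_one (M := M (pauli 2) (pauli 2))
    (by simpa using hX _ _ _ _ X2 X2) (by simpa using hZ _ _ _ _ Z2 Z2)
  obtain ⟨d₃, h33⟩ := exists_eq_smul_one (M := M (pauli 3) (pauli 3))
    (by simpa using hX _ _ _ _ X3 X3) (by simpa using hZ _ _ _ _ Z3 Z3)
  obtain ⟨c₁, h23⟩ := exists_eq_smul_pauli_one (M := M (pauli 2) (pauli 3))
    (by simpa using hX _ _ _ _ X2 X3) (by simpa using hZ _ _ _ _ Z2 Z3)
  obtain ⟨c₂, h31⟩ := exists_eq_smul_pauli_two (M := M (pauli 3) (pauli 1))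
    (by simpa using hX _ _ _ _ X3 X1) (by simpa using hZ _ _ _ _ Z3 Z1)
  obtain ⟨c₃, h12⟩ := exists_eq_smul_pauli_three (M := M (pauli 1) (pauli 2))
    (by simpa using hX _ _ _ _ X1 X2) (by simpa using hZ _ _ _ _ Z1 Z2)
  obtain ⟨e₁, h32⟩ := exists_eq_smul_pauli_one (M := M (pauli 3) (pauli 2))
    (by simpa using hX _ _ _ _ X3 X2) (by simpa using hZ _ _ _ _ Z3 Z2)
  obtain ⟨e₂, h13⟩ := exists_eq_smul_pauli_two (M := M (pauli 1) (pauli 3))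
    (by simpa using hX _ _ _ _ X1 X3) (by simpa using hZ _ _ _ _ Z1 Z3)
  obtain ⟨e₃, h21⟩ := exists_eq_smul_pauli_three (M := M (pauli 2) (pauli 1))
    (by simpa using hX _ _ _ _ X2 X1) (by simpa using hZ _ _ _ _ Z2 Z1)
  have f1 := hF _ _ _ _ F1 F2
  have f2 := hF _ _ _ _ F2 F3
  have f3 := hF _ _ _ _ F2 F1
  have f4 := hF _ _ _ _ F3 F2
  rw [h12, h23, Matrix.mul_smul, F3, ← Matrix.smul_mul] at f1
  have e1 : c₃ = c₁ := smul_left_injective ℂ (pauli_ne_zero 1) (SU2.mul_right_cancel_coe _ f1)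
  rw [h23, h31, Matrix.mul_smul, F1, ← Matrix.smul_mul] at f2
  have e2 : c₁ = c₂ := smul_left_injective ℂ (pauli_ne_zero 2) (SU2.mul_right_cancel_coe _ f2)
  rw [h21, h32, Matrix.mul_smul, F3, ← Matrix.smul_mul] at f3
  have e3 : e₃ = e₁ := smul_left_injective ℂ (pauli_ne_zero 1) (SU2.mul_right_cancel_coe _ f3)
  rw [h32, h13, Matrix.mul_smul, F1, ← Matrix.smul_mul] at f4
  have e4 : e₁ = e₂ := smul_left_injective ℂ (pauli_ne_zero 2) (SU2.mul_right_cancel_coe _ f4)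
  subst e1 e2 e3 e4
  have p1 := hP _ _ _ _ P1 P1
  have p2 := hP _ _ _ _ P1 P2
  simp only [map_add, map_sub, map_smul, LinearMap.add_apply, LinearMap.sub_apply,
    LinearMap.smul_apply, h11, h22, h33, h12, h23, h31, h21, h32, h13] at p1 p2
  rw [Matrix.mul_smul, mul_one, ← one_mul gatePhiGalois.1, ← mul_assoc, mul_one,
    ← Matrix.smul_mul] at p1
  rw [Matrix.mul_smul, G3, ← Matrix.smul_mul] at p2
  have q1 := SU2.mul_right_cancel_coe _ p1
  have q2 := SU2.mul_right_cancel_coe _ p2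
  have s1 := congrFun (congrFun q1 0) 0
  have s2 := congrFun (congrFun q1 1) 1
  have s3 := congrFun (congrFun q2 0) 1
  have s4 := congrFun (congrFun q2 1) 0
  simp [pauli] at s1 s2 s3 s4
  have hs := sqrt_five_coe_sq
  have hs0 : ((√5 : ℝ) : ℂ) ≠ 0 := fun h => by simp [h] at hs
  have hs1 : ((√5 : ℝ) : ℂ) - 1 ≠ 0 := fun h => by
    rw [sub_eq_zero.1 h] at hs
    norm_num at hs
  -- `M (pauli 1) (pauli 1)` is scalar, so the `pauli 3` component after `Φ` must vanish; it is
  -- proportional to `(√5 - 1) * (e₃ + c₃)`. What remains on mixed pairs is a multiple of the cross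
  -- product, a map from `3` to `3'`, and the next step kills it.
  have he : e₃ = -c₃ := by
    have : (((√5 : ℝ) : ℂ) - 1) * (e₃ + c₃) = 0 := by linear_combination 4 * s1 - 4 * s2
    linear_combination (mul_eq_zero.1 this).resolve_left hs1
  subst he
  have hc : c₃ = 0 := by
    refine (mul_eq_zero.1 (?_ : ((√5 : ℝ) : ℂ) * c₃ = 0)).resolve_left hs0
    linear_combination s3 + s4 - c₃ / 8 * hs
  subst hc
  rw [neg_zero] at h32 h13 h21
  have h0 : ∀ {A : Matrix (Fin 2) (Fin 2) ℂ}, A = 0 → ∃ c : ℂ, A = c • 1 :=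
    fun h => ⟨0, h.trans (zero_smul _ _).symm⟩
  have hz : ∀ {A P : Matrix (Fin 2) (Fin 2) ℂ}, A = (0 : ℂ) • P → ∃ c : ℂ, A = c • 1 :=
    fun h => h0 (h.trans (zero_smul _ _))
  fin_cases a <;> fin_cases b
  exacts [⟨_, h00⟩, h0 r1, h0 r2, h0 r3, h0 l1, ⟨_, h11⟩, hz h12, hz h13, h0 l2, hz h21, ⟨_, h22⟩,
    hz h23, h0 l3, hz h31, hz h32, ⟨_, h33⟩]

/-! ### Galois conjugation and transversal gates -/

/-- `z'` is obtained from `z ∈ ℚ(√5, i)` by `√5 ↦ -√5`. -/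
def IsGaloisConj (z z' : ℂ) : Prop :=
  ∃ a b c d : ℚ, z = a + b * (√5 : ℝ) + Complex.I * (c + d * (√5 : ℝ)) ∧
    z' = a - b * (√5 : ℝ) + Complex.I * (c - d * (√5 : ℝ))

lemma IsGaloisConj.add {z z' w w' : ℂ} (hz : IsGaloisConj z z') (hw : IsGaloisConj w w') :
    IsGaloisConj (z + w) (z' + w') := by
  obtain ⟨a, b, c, d, rfl, rfl⟩ := hz
  obtain ⟨e, f, g, h, rfl, rfl⟩ := hw
  refine ⟨a + e, b + f, c + g, d + h, ?_, ?_⟩ <;> push_cast <;> ring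

lemma IsGaloisConj.mul {z z' w w' : ℂ} (hz : IsGaloisConj z z') (hw : IsGaloisConj w w') :
    IsGaloisConj (z * w) (z' * w') := by
  obtain ⟨a, b, c, d, rfl, rfl⟩ := hz
  obtain ⟨e, f, g, h, rfl, rfl⟩ := hw
  have h5 := sqrt_five_coe_sq
  have hI := Complex.I_sq
  refine ⟨a * e + 5 * b * f - (c * g + 5 * d * h), a * f + b * e - (c * h + d * g),
    a * g + 5 * b * h + c * e + 5 * d * f, a * h + b * g + c * f + d * e, ?_, ?_⟩ <;> push_cast <;>
    generalize ((√5 : ℝ) : ℂ) = s at h5 ⊢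
  · linear_combination (b * f - d * h + Complex.I * (b * h + d * f)) * h5 +
      (c + d * s) * (g + h * s) * hI
  · linear_combination (b * f - d * h + Complex.I * (b * h + d * f)) * h5 +
      (c - d * s) * (g - h * s) * hI

lemma IsGaloisConj.star {z z' : ℂ} (hz : IsGaloisConj z z') :
    IsGaloisConj (star z) (star z') := by
  obtain ⟨a, b, c, d, rfl, rfl⟩ := hz
  refine ⟨a, b, -c, -d, ?_, ?_⟩ <;> simp <;> ring

/-- The entrywise relation holds on generators and survives sums, products and complex conjugation;
the latter suffices for inverses because the inverse in `SU(2)` is the conjugate transpose. -/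
lemma isGaloisConj_of_mem_closure {p : SU2 × SU2}
    (hp : p ∈ Subgroup.closure galoisGenerators) (i j : Fin 2) :
    IsGaloisConj (p.1.1 i j) (p.2.1 i j) := by
  induction hp using Subgroup.closure_induction generalizing i j with
  | mem p hp =>
    have h0 : IsGaloisConj 0 0 := ⟨0, 0, 0, 0, by simp, by simp⟩
    have hI : IsGaloisConj Complex.I Complex.I := ⟨0, 0, 1, 0, by simp, by simp⟩
    have hnI : IsGaloisConj (-Complex.I) (-Complex.I) := ⟨0, 0, -1, 0, by simp, by simp⟩
    rcases hp with rfl | rfl | rfl | rfl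
    · fin_cases i <;> fin_cases j <;> simpa [gateX, su2Mk]
    · fin_cases i <;> fin_cases j <;> simpa [gateZ, su2Mk]
    · rw [gateF_coe]
      fin_cases i <;> fin_cases j <;> simp
      · exact ⟨1 / 2, 0, -1 / 2, 0, by push_cast; ring, by push_cast; ring⟩
      · exact ⟨-1 / 2, 0, -1 / 2, 0, by push_cast; ring, by push_cast; ring⟩
      · exact ⟨1 / 2, 0, -1 / 2, 0, by push_cast; ring, by push_cast; ring⟩
      · exact ⟨1 / 2, 0, 1 / 2, 0, by push_cast; ring, by push_cast; ring⟩
    · rw [gatePhi_coe, gatePhiGalois_coe]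
      fin_cases i <;> fin_cases j <;> simp
      · exact ⟨1 / 4, 1 / 4, -1 / 4, 1 / 4, by push_cast; ring, by push_cast; ring⟩
      · exact ⟨1 / 2, 0, 0, 0, by push_cast; ring, by push_cast; ring⟩
      · exact ⟨-1 / 2, 0, 0, 0, by push_cast; ring, by push_cast; ring⟩
      · exact ⟨1 / 4, 1 / 4, 1 / 4, -1 / 4, by push_cast; ring, by push_cast; ring⟩
  | one =>
    have h0 : IsGaloisConj 0 0 := ⟨0, 0, 0, 0, by simp, by simp⟩
    have h1 : IsGaloisConj 1 1 := ⟨1, 0, 0, 0, by simp, by simp⟩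
    fin_cases i <;> fin_cases j <;> simpa
  | mul p q _ _ hp hq =>
    simp only [Prod.fst_mul, Prod.snd_mul, Submonoid.coe_mul, Matrix.mul_apply, Fin.sum_univ_two]
    exact ((hp _ _).mul (hq _ _)).add ((hp _ _).mul (hq _ _))
  | inv p _ hp => exact (hp j i).star

lemma SU2.apply_one_one (g : SU2) : g.1 1 1 = star (g.1 0 0) := by
  obtain ⟨hu, hd⟩ := Matrix.mem_specialUnitaryGroup_iff.1 g.2
  have h1 : star g.1 * g.1 = 1 := Matrix.mem_unitaryGroup_iff'.1 hu
  have h2 : g.1 * g.1.adjugate = 1 := by rw [Matrix.mul_adjugate, hd, one_smul]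
  have h3 : star g.1 = g.1.adjugate := left_inv_eq_right_inv h1 h2
  have := congrFun (congrFun h3 0) 0
  rw [Matrix.adjugate_fin_two] at this
  simpa using this.symm

/-- The trace is twice the real part of the corner entry, so the multiples of `i` drop out and only
`ℚ(√5)` is left. -/
lemma trace_of_mem_closure {p : SU2 × SU2} (hp : p ∈ Subgroup.closure galoisGenerators) :
    ∃ a b : ℚ, Matrix.trace p.1.1 = (a : ℂ) + (b : ℂ) * (√5 : ℝ) ∧
      Matrix.trace p.2.1 = (a : ℂ) - (b : ℂ) * (√5 : ℝ) := by
  obtain ⟨a, b, c, d, h, h'⟩ := isGaloisConj_of_mem_closure hp 0 0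
  refine ⟨2 * a, 2 * b, ?_, ?_⟩
  · rw [Matrix.trace_fin_two, SU2.apply_one_one, h]
    simp
    ring
  · rw [Matrix.trace_fin_two, SU2.apply_one_one, h']
    simp
    ring

/-- The first projection of the Galois graph is `twoI`, since it maps generators to generators.
Uniqueness of the partner is not needed. -/
lemma exists_mem_closure_of_mem_twoI {g : SU2} (hg : g ∈ twoI) :
    ∃ r, (g, r) ∈ Subgroup.closure galoisGenerators := by
  have h : (Subgroup.closure galoisGenerators).map (MonoidHom.fst SU2 SU2) = twoI := by
    rw [MonoidHom.map_closure, twoI]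
    simp [galoisGenerators, Set.image_insert_eq]
  rw [← h] at hg
  obtain ⟨⟨g', r⟩, hr, rfl⟩ := hg
  exact ⟨r, hr⟩

/-- An orthonormal pair which transforms by the Galois conjugates spans a copy of `π̄₂`. -/
lemma transformsInPiBarTwo_span {n : ℕ} {u : Fin 2 → SpinSpace n} (hu : Orthonormal ℂ u)
    (hcov : Subgroup.closure galoisGenerators ≤ covarianceGroup u) :
    TransformsInPiBarTwo (Submodule.span ℂ (Set.range u)) := by
  have hS : ∀ g ∈ twoI, ∀ v ∈ Submodule.span ℂ (Set.range u),
      wignerD n g v ∈ Submodule.span ℂ (Set.range u) := by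
    intro g hg v hv
    obtain ⟨r, hr⟩ := exists_mem_closure_of_mem_twoI hg
    rw [← Submodule.mem_comap]
    refine Submodule.span_le.2 ?_ hv
    rintro _ ⟨k, rfl⟩
    rw [SetLike.mem_coe, Submodule.mem_comap, hcov hr k]
    exact Submodule.sum_mem _ fun l _ => Submodule.smul_mem _ _
      (Submodule.subset_span (Set.mem_range_self l))
  refine ⟨hS, fun g hg => ?_⟩
  obtain ⟨r, hr⟩ := exists_mem_closure_of_mem_twoI hg
  obtain ⟨a, b, h1, h2⟩ := trace_of_mem_closure hr
  refine ⟨a, b, h1, ?_⟩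
  rw [← h2]
  set B := Module.Basis.span hu.linearIndependent with hB
  rw [LinearMap.trace_eq_matrix_trace ℂ B]
  congr 1
  ext i k
  rw [LinearMap.toMatrix_apply]
  -- In the basis `u` the rotation has matrix `r`, whose trace is already known.
  have : (wignerD n g).restrict (hS g hg) (B k) = ∑ l, r.1 l k • B l := by
    apply Subtype.ext
    rw [LinearMap.coe_restrict_apply]
    simp only [Submodule.coe_sum, Submodule.coe_smul, hB, Module.Basis.span_apply]
    exact hcov hr k
  rw [this, B.repr_sum_self]

/-- The logical gates which are implemented by transversal gates `h ⊗ ⋯ ⊗ h`. -/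
def transversalGroup {n : ℕ} (b : Fin 2 → Qubits n) : Subgroup SU2 where
  carrier := {g | ∃ h ∈ Matrix.unitaryGroup (Fin 2) ℂ, ∀ k : Fin 2,
    tensorOp (fun _ : Fin n => h) (b k) = ∑ l : Fin 2, g.1 l k • b l}
  one_mem' := ⟨1, one_mem _, fun k => by
    rw [tensorOp_one]
    fin_cases k <;> simp [Fin.sum_univ_two]⟩
  mul_mem' := by
    rintro p q ⟨h, hh, hp⟩ ⟨h', hh', hq⟩
    refine ⟨h * h', mul_mem hh hh', fun k => ?_⟩
    rw [tensorOp_mul_apply, hq k, map_sum]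
    simp only [map_smul, hp, Submonoid.coe_mul, Matrix.mul_apply, Fin.sum_univ_two, smul_add,
      smul_smul, add_smul]
    module
  inv_mem' := by
    rintro p ⟨h, hh, hp⟩
    refine ⟨star h, Unitary.star_mem hh, fun k => ?_⟩
    have h1 : ∀ v : Qubits n, tensorOp (fun _ => star h) (tensorOp (fun _ => h) v) = v := fun v => by
      rw [← tensorOp_mul_apply, Matrix.mem_unitaryGroup_iff'.1 hh, tensorOp_one]
    have h2 : ∀ l, ∑ m, p.1 m l • tensorOp (fun _ => star h) (b m) = b l := fun l => by
      rw [← h1 (b l), hp l, map_sum]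
      simp only [map_smul]
    have h3 : p.1 * (p⁻¹).1 = 1 := congrArg Subtype.val (mul_inv_cancel p)
    have h4 := fun i j => congrFun (congrFun h3 i) j
    simp only [Matrix.mul_apply] at h4
    have h5 : ∑ l, (p⁻¹).1 l k • b l =
        ∑ l, (p⁻¹).1 l k • ∑ m, p.1 m l • tensorOp (fun _ => star h) (b m) :=
      Finset.sum_congr rfl fun l _ => by rw [h2 l]
    rw [h5]
    simp only [Finset.smul_sum, smul_smul]
    rw [Finset.sum_comm]
    simp only [← Finset.sum_smul]
    simp only [mul_comm _ (p.1 _ _), h4]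
    simp [Matrix.one_apply]

lemma mem_transversalGroup_dickeMap {n : ℕ} {u : Fin 2 → SpinSpace n} {p : SU2 × SU2}
    (hp : p ∈ covarianceGroup u) : p.2 ∈ transversalGroup fun k => dickeMap n (u k) :=
  ⟨p.1.1, (Matrix.mem_specialUnitaryGroup_iff.1 p.1.2).1, fun k => by
    rw [tensorOp_dickeMap, hp k, map_sum]
    simp only [map_smul]⟩

/-- `ZX` is proportional to Pauli `Y`, conjugation by which is entrywise complex conjugation on
`SU(2)`; and `XZ` is the inverse of `ZX`. -/
lemma gatePhiStar_eq : gatePhiStar = gateZ * gateX * gatePhiGalois * gateX * gateZ := by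
  apply Subtype.ext
  have hI := Complex.I_sq
  simp only [Submonoid.coe_mul, gatePhiStar_coe, gatePhiGalois_coe, gateX_coe, gateZ_coe, pauli]
  ext i j
  fin_cases i <;> fin_cases j <;> simp [Matrix.mul_apply, Fin.sum_univ_two] <;> grind

lemma twoIStar_le_transversalGroup {n : ℕ} {u : Fin 2 → SpinSpace n}
    (hcov : Subgroup.closure galoisGenerators ≤ covarianceGroup u) :
    twoIStar ≤ transversalGroup fun k => dickeMap n (u k) := by
  have h : ∀ p ∈ galoisGenerators, p.2 ∈ transversalGroup fun k => dickeMap n (u k) :=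
    fun p hp => mem_transversalGroup_dickeMap (hcov (Subgroup.subset_closure hp))
  have hX := h (gateX, gateX) (by simp [galoisGenerators])
  have hZ := h (gateZ, gateZ) (by simp [galoisGenerators])
  have hF := h (gateF, gateF) (by simp [galoisGenerators])
  have hP := h (gatePhi, gatePhiGalois) (by simp [galoisGenerators])
  rw [twoIStar, Subgroup.closure_le]
  rintro _ (rfl | rfl | rfl | rfl)
  · exact hX
  · exact hZ
  · exact hF
  · rw [gatePhiStar_eq]
    exact mul_mem (mul_mem (mul_mem (mul_mem hZ hX) hP) hX) hZ

/-- The logical basis in which the logical gates are conjugated by the phase gate. -/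
noncomputable def phaseBasis {n : ℕ} (b : Fin 2 → Qubits n) : Fin 2 → Qubits n :=
  ![b 0, Complex.I • b 1]

/-- The hypothesis `h` says `r = S g S⁻¹` for the phase gate `S = diag(1, i)`, which is exactly the
change to the phase basis. -/
lemma mem_transversalGroup_phaseBasis {n : ℕ} {b : Fin 2 → Qubits n} {g r : SU2}
    (hr : r ∈ transversalGroup b)
    (h : r.1 = !![g.1 0 0, -Complex.I * g.1 0 1; Complex.I * g.1 1 0, g.1 1 1]) :
    g ∈ transversalGroup (phaseBasis b) := by
  obtain ⟨a, ha, hb⟩ := hr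
  refine ⟨a, ha, fun k => ?_⟩
  have hI := Complex.I_mul_I
  fin_cases k
  · simp [phaseBasis, Fin.sum_univ_two, hb, h, smul_smul, mul_comm]
  · simp only [phaseBasis, Fin.sum_univ_two, hb, h, map_smul, Fin.mk_one, Matrix.cons_val_zero,
      Matrix.cons_val_one, Matrix.of_apply, Matrix.cons_val', Matrix.cons_val_fin_one, smul_add,
      smul_smul]
    congr 2
    · linear_combination -g.1 0 1 * hI
    · ring

/-- Conjugation by the phase gate carries `2I` into `2I⋆`: the conjugates of `X, Z, F, Φ` are the
words `ZX`, `Z`, `XZFF`, `ZΦ⋆`. -/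
lemma twoI_le_transversalGroup_phaseBasis {n : ℕ} {b : Fin 2 → Qubits n}
    (h : twoIStar ≤ transversalGroup b) : twoI ≤ transversalGroup (phaseBasis b) := by
  have hX := h (Subgroup.subset_closure (by simp) : gateX ∈ twoIStar)
  have hZ := h (Subgroup.subset_closure (by simp) : gateZ ∈ twoIStar)
  have hF := h (Subgroup.subset_closure (by simp) : gateF ∈ twoIStar)
  have hP := h (Subgroup.subset_closure (by simp) : gatePhiStar ∈ twoIStar)
  have hI := Complex.I_sq
  rw [twoI, Subgroup.closure_le]
  rintro _ (rfl | rfl | rfl | rfl)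
  · refine mem_transversalGroup_phaseBasis (mul_mem hZ hX) ?_
    simp only [Submonoid.coe_mul, gateX_coe, gateZ_coe, pauli]
    ext i j
    fin_cases i <;> fin_cases j <;> simp [Matrix.mul_apply, Fin.sum_univ_two]
  · refine mem_transversalGroup_phaseBasis hZ ?_
    simp only [gateZ_coe, pauli]
    ext i j
    fin_cases i <;> fin_cases j <;> simp
  · refine mem_transversalGroup_phaseBasis (mul_mem (mul_mem (mul_mem hX hZ) hF) hF) ?_
    simp only [Submonoid.coe_mul, gateX_coe, gateZ_coe, gateF_coe, pauli]
    ext i j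
    fin_cases i <;> fin_cases j <;> simp [Matrix.mul_apply, Fin.sum_univ_two] <;> grind
  · refine mem_transversalGroup_phaseBasis (mul_mem hZ hP) ?_
    simp only [Submonoid.coe_mul, gatePhiStar_coe, gatePhi_coe, gateZ_coe, pauli]
    ext i j
    fin_cases i <;> fin_cases j <;> simp [Matrix.mul_apply, Fin.sum_univ_two] <;> grind

/-! ### Two-site errors and the Knill-Laflamme conditions -/

lemma prod_update_apply {n : ℕ} (A : Fin n → Matrix (Fin 2) (Fin 2) ℂ) (i : Fin n)
    (B : Matrix (Fin 2) (Fin 2) ℂ) (s t : Fin n → Fin 2) :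
    ∏ k, Function.update A i B k (s k) (t k) =
      B (s i) (t i) * ∏ k ∈ Finset.univ.erase i, A k (s k) (t k) := by
  rw [← Finset.mul_prod_erase _ _ (Finset.mem_univ i), Function.update_self]
  congr 1
  refine Finset.prod_congr rfl fun k hk => ?_
  rw [Function.update_of_ne (Finset.ne_of_mem_erase hk)]

lemma tensorOp_update_add {n : ℕ} (A : Fin n → Matrix (Fin 2) (Fin 2) ℂ) (i : Fin n)
    (B B' : Matrix (Fin 2) (Fin 2) ℂ) (v : Qubits n) :
    tensorOp (Function.update A i (B + B')) v =
      tensorOp (Function.update A i B) v + tensorOp (Function.update A i B') v := by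
  ext s
  simp only [PiLp.add_apply, tensorOp_apply, prod_update_apply, Matrix.add_apply, add_mul,
    Finset.sum_add_distrib]

lemma tensorOp_update_smul {n : ℕ} (A : Fin n → Matrix (Fin 2) (Fin 2) ℂ) (i : Fin n) (c : ℂ)
    (B : Matrix (Fin 2) (Fin 2) ℂ) (v : Qubits n) :
    tensorOp (Function.update A i (c • B)) v = c • tensorOp (Function.update A i B) v := by
  ext s
  simp only [PiLp.smul_apply, tensorOp_apply, prod_update_apply, Matrix.smul_apply, smul_eq_mul,
    Finset.mul_sum, mul_assoc]

/-- The operator which acts by `A` on qubit `i` and by `B` on qubit `j`. -/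
noncomputable def twoSiteOp {n : ℕ} (i j : Fin n) (A B : Matrix (Fin 2) (Fin 2) ℂ) :
    Qubits n →ₗ[ℂ] Qubits n :=
  tensorOp (Function.update (Function.update 1 i A) j B)

/-- The matrix elements of two-site operators between the vectors `b 0` and `b 1`. -/
noncomputable def twoSiteMatrix {n : ℕ} (b : Fin 2 → Qubits n) {i j : Fin n} (hij : i ≠ j) :
    Matrix (Fin 2) (Fin 2) ℂ →ₗ[ℂ] Matrix (Fin 2) (Fin 2) ℂ →ₗ[ℂ] Matrix (Fin 2) (Fin 2) ℂ :=
  LinearMap.mk₂ ℂ (fun A B => Matrix.of fun k l => inner ℂ (b k) (twoSiteOp i j A B (b l)))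
    (fun A A' B => by
      ext k l
      simp only [twoSiteOp, Matrix.of_apply, Matrix.add_apply, Function.update_comm hij,
        tensorOp_update_add, inner_add_right])
    (fun c A B => by
      ext k l
      simp only [twoSiteOp, Matrix.of_apply, Matrix.smul_apply, Function.update_comm hij,
        tensorOp_update_smul, inner_smul_right, smul_eq_mul])
    (fun A B B' => by
      ext k l
      simp only [twoSiteOp, Matrix.of_apply, Matrix.add_apply, tensorOp_update_add,
        inner_add_right])
    (fun c A B => by
      ext k l
      simp only [twoSiteOp, Matrix.of_apply, Matrix.smul_apply, tensorOp_update_smul,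
        inner_smul_right, smul_eq_mul])

lemma tensorOp_twoSiteOp {n : ℕ} (i j : Fin n) {g A A' B B' : Matrix (Fin 2) (Fin 2) ℂ}
    (hA : g * A = A' * g) (hB : g * B = B' * g) (v : Qubits n) :
    tensorOp (fun _ => g) (twoSiteOp i j A B v) =
      twoSiteOp i j A' B' (tensorOp (fun _ => g) v) := by
  rw [twoSiteOp, twoSiteOp, ← tensorOp_mul_apply, ← tensorOp_mul_apply]
  congr 2
  funext k
  by_cases hj : k = j
  · subst hj; simpa
  by_cases hi : k = i
  · subst hi; simpa [hj]
  · simp [hi, hj]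

/-- Apply the unitary `g ⊗ ⋯ ⊗ g` to both arguments of the inner product, move it past the two-site
operator, and let it act on the codewords through `r`. -/
lemma twoSiteMatrix_equivariant {n : ℕ} {b : Fin 2 → Qubits n} {i j : Fin n} (hij : i ≠ j)
    {g r : SU2} (hb : ∀ k, tensorOp (fun _ => g.1) (b k) = ∑ l, r.1 l k • b l)
    {A A' B B' : Matrix (Fin 2) (Fin 2) ℂ} (hA : g.1 * A = A' * g.1) (hB : g.1 * B = B' * g.1) :
    r.1 * twoSiteMatrix b hij A B = twoSiteMatrix b hij A' B' * r.1 := by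
  have h : twoSiteMatrix b hij A B = star r.1 * (twoSiteMatrix b hij A' B' * r.1) := by
    ext k l
    have h1 : twoSiteMatrix b hij A B k l = inner ℂ (b k) (twoSiteOp i j A B (b l)) := rfl
    have h2 : ∀ k l, twoSiteMatrix b hij A' B' k l =
      inner ℂ (b k) (twoSiteOp i j A' B' (b l)) := fun _ _ => rfl
    rw [h1, ← inner_tensorOp_tensorOp (Matrix.mem_specialUnitaryGroup_iff.1 g.2).1,
      tensorOp_twoSiteOp i j hA hB, hb, hb, map_sum]
    simp only [Matrix.mul_apply, Matrix.star_apply, h2, Fin.sum_univ_two, map_smul, inner_add_left,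
      inner_add_right, inner_smul_left, inner_smul_right, RCLike.star_def]
    ring
  rw [h, ← mul_assoc, Matrix.mem_unitaryGroup_iff.1 (Matrix.mem_specialUnitaryGroup_iff.1 r.2).1,
    one_mul]

lemma exists_eq_twoSite_of_pauliWeight_lt {n : ℕ} (hn : 2 ≤ n) {p : Fin n → Fin 4}
    (hp : pauliWeight p < 3) : ∃ i j, i ≠ j ∧
      tensorOp (fun k => pauli (p k)) = twoSiteOp i j (pauli (p i)) (pauli (p j)) := by
  -- The support has at most two sites and is padded to exactly two; a padded site carries `pauli
  -- 0`, the identity.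
  obtain ⟨T, hT, hc⟩ := Finset.exists_superset_card_eq (Nat.lt_succ_iff.1 hp)
    (by simpa using hn)
  obtain ⟨i, j, hij, rfl⟩ := Finset.card_eq_two.1 hc
  refine ⟨i, j, hij, ?_⟩
  rw [twoSiteOp]
  congr 1
  funext k
  by_cases hj : k = j
  · subst hj; simp
  by_cases hi : k = i
  · subst hi; simp [hj]
  · have : p k = 0 := by
      by_contra h
      have := hT (Finset.mem_filter.2 ⟨Finset.mem_univ k, h⟩)
      simp [hi, hj] at this
    simp [hi, hj, this, pauli]

/-- An orthonormal pair which transforms by the Galois conjugates spans a code of distance 3. -/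
lemma hasDistance_three_span {n : ℕ} (hn : 2 ≤ n) {b : Fin 2 → Qubits n} (hb : Orthonormal ℂ b)
    (hcov : ∀ p ∈ galoisGenerators, ∀ k,
      tensorOp (fun _ => p.1.1) (b k) = ∑ l, p.2.1 l k • b l) :
    HasDistance 3 (Submodule.span ℂ (Set.range b)) := by
  intro p hp
  obtain ⟨i, j, hij, hE⟩ := exists_eq_twoSite_of_pauliWeight_lt hn hp
  obtain ⟨c, hc⟩ := equivariant_apply_pauli_pauli (twoSiteMatrix b hij)
    (fun q hq A A' B B' hA hB => twoSiteMatrix_equivariant hij (hcov q hq) hA hB) (p i) (p j)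
  refine ⟨c, fun u hu v hv => ?_⟩
  have h : ∀ k l, inner ℂ (b k) (tensorOp (fun k => pauli (p k)) (b l)) =
      c * inner ℂ (b k) (b l) := by
    intro k l
    have := congrFun (congrFun hc k) l
    rw [hE, orthonormal_iff_ite.1 hb k l, Matrix.smul_apply, Matrix.one_apply] at *
    exact this
  obtain ⟨x, rfl⟩ := (Submodule.mem_span_range_iff_exists_fun ℂ).1 hu
  obtain ⟨y, rfl⟩ := (Submodule.mem_span_range_iff_exists_fun ℂ).1 hv
  simp only [Fin.sum_univ_two, map_add, map_smul, inner_add_left, inner_add_right, inner_smul_left,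
    inner_smul_right, h]
  ring

lemma isPermutationallyInvariant_map_dickeMap {n : ℕ} (S : Submodule ℂ (SpinSpace n)) :
    IsPermutationallyInvariant (S.map (dickeMap n)) := by
  rintro _ ⟨v, -, rfl⟩ σ s
  have h : hammingWeight (s ∘ σ) = hammingWeight s := by
    rw [hammingWeight, hammingWeight]
    exact Finset.card_equiv σ (by simp)
  obtain ⟨a, ha⟩ : ∃ a : Fin (n + 1), hammingWeight s = a :=
    ⟨⟨hammingWeight s, Nat.lt_succ_of_le (hammingWeight_le s)⟩, rfl⟩
  rw [dickeMap_apply v s a ha, dickeMap_apply v _ a (h.trans ha)]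

lemma orthonormal_phaseBasis {n : ℕ} {b : Fin 2 → Qubits n} (hb : Orthonormal ℂ b) :
    Orthonormal ℂ (phaseBasis b) := by
  have h := orthonormal_iff_ite.1 hb
  rw [orthonormal_iff_ite]
  intro i j
  fin_cases i <;> fin_cases j <;> simp [phaseBasis, inner_smul_left, inner_smul_right, norm_smul, hb.1, h]

lemma span_phaseBasis {n : ℕ} (b : Fin 2 → Qubits n) :
    Submodule.span ℂ (Set.range (phaseBasis b)) = Submodule.span ℂ (Set.range b) := by
  apply le_antisymm <;> rw [Submodule.span_le]
  · rintro _ ⟨k, rfl⟩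
    have h : ∀ l, b l ∈ Submodule.span ℂ (Set.range b) :=
      fun l => Submodule.subset_span (Set.mem_range_self l)
    fin_cases k
    · exact h 0
    · exact Submodule.smul_mem _ _ (h 1)
  · rintro _ ⟨k, rfl⟩
    have h : ∀ l, phaseBasis b l ∈ Submodule.span ℂ (Set.range (phaseBasis b)) :=
      fun l => Submodule.subset_span (Set.mem_range_self l)
    fin_cases k
    · exact h 0
    · have : b 1 = (-Complex.I) • phaseBasis b 1 := by
        simp [phaseBasis, smul_smul]
      simpa [this] using Submodule.smul_mem _ (-Complex.I) (h 1)

/-- Covariant pairs of spin states yield codes with transversal binary icosahedral gates. -/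
lemma code_of_covariant {n : ℕ} (hn : 2 ≤ n) {u : Fin 2 → SpinSpace n} (hu : Orthonormal ℂ u)
    (hcov : Subgroup.closure galoisGenerators ≤ covarianceGroup u) :
    ∃ C : Submodule ℂ (Qubits n),
      C = (Submodule.span ℂ (Set.range u)).map (dickeMap n) ∧
      IsCode n 2 3 C ∧
      IsPermutationallyInvariant C ∧
      ImplementsStronglyTransversally twoIStar (fun k => dickeMap n (u k)) ∧
      (∃ b : Fin 2 → Qubits n, Orthonormal ℂ b ∧ Submodule.span ℂ (Set.range b) = C ∧
        ImplementsStronglyTransversally twoI b) := by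
  have hb : Orthonormal ℂ fun k => dickeMap n (u k) := by
    rw [orthonormal_iff_ite]
    intro i j
    rw [inner_dickeMap, orthonormal_iff_ite.1 hu]
  have hspan : (Submodule.span ℂ (Set.range u)).map (dickeMap n) =
      Submodule.span ℂ (Set.range fun k => dickeMap n (u k)) := by
    rw [Submodule.map_span, ← Set.range_comp]
    rfl
  refine ⟨_, rfl, ⟨?_, ?_⟩, isPermutationallyInvariant_map_dickeMap _,
    twoIStar_le_transversalGroup hcov, phaseBasis fun k => dickeMap n (u k),
    orthonormal_phaseBasis hb, ?_,
    twoI_le_transversalGroup_phaseBasis (twoIStar_le_transversalGroup hcov)⟩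
  · rw [hspan, finrank_span_eq_card hb.linearIndependent, Fintype.card_fin]
  · rw [hspan]
    refine hasDistance_three_span hn hb fun p hp k => ?_
    rw [tensorOp_dickeMap, hcov (Subgroup.subset_closure hp) k, map_sum]
    simp only [map_smul]
  · rw [span_phaseBasis, hspan]

/-! ### Basic covariants of the binary icosahedral group -/

section Substitution

variable {s i x y X Y : ℂ}

/-- The quadratic monomials under the substitution `Φ`. -/
lemma quadratic_gatePhi (hs : s ^ 2 = 5) (hi : i ^ 2 = -1)
    (hX : X = (1 + s + i * (s - 1)) / 4 * x + -1 / 2 * y)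
    (hY : Y = 1 / 2 * x + (1 + s - i * (s - 1)) / 4 * y) :
    X ^ 2 = ((s + 2 * i) * x ^ 2 + (-1 - s + i - s * i) * x * y + y ^ 2) / 4 ∧
    X * Y = ((1 + s - i + s * i) * x ^ 2 + 4 * x * y + (-1 - s - i + s * i) * y ^ 2) / 8 ∧
    Y ^ 2 = (x ^ 2 + (1 + s + i - s * i) * x * y + (s - 2 * i) * y ^ 2) / 4 := by
  subst hX hY
  refine ⟨?_, ?_, ?_⟩ <;> ring_nf <;> simp only [hs, hi] <;> ring

/-- The quartic monomials under the substitution `Φ`. -/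
lemma quartic_gatePhi (hs : s ^ 2 = 5) (hi : i ^ 2 = -1)
    (hX : X = (1 + s + i * (s - 1)) / 4 * x + -1 / 2 * y)
    (hY : Y = 1 / 2 * x + (1 + s - i * (s - 1)) / 4 * y) :
    X ^ 4 = ((1 + 4 * s * i) * x ^ 4 + (-14 + 2 * s - 14 * i - 2 * s * i) * x ^ 3 * y +
      (6 * s + 12 * i) * x ^ 2 * y ^ 2 + (-2 - 2 * s + 2 * i - 2 * s * i) * x * y ^ 3 +
      y ^ 4) / 16 ∧
    X ^ 2 * Y ^ 2 = ((s + 2 * i) * x ^ 4 + (2 + 2 * s - 2 * i + 2 * s * i) * x ^ 3 * y -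
      2 * x ^ 2 * y ^ 2 + (-2 - 2 * s - 2 * i + 2 * s * i) * x * y ^ 3 +
      (s - 2 * i) * y ^ 4) / 16 ∧
    Y ^ 4 = (x ^ 4 + (2 + 2 * s + 2 * i - 2 * s * i) * x ^ 3 * y +
      (6 * s - 12 * i) * x ^ 2 * y ^ 2 + (14 - 2 * s - 14 * i - 2 * s * i) * x * y ^ 3 +
      (1 - 4 * s * i) * y ^ 4) / 16 := by
  obtain ⟨h0, h1, h2⟩ := quadratic_gatePhi hs hi hX hY
  clear hX hY
  refine ⟨?_, ?_, ?_⟩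
  · rw [show X ^ 4 = (X ^ 2) ^ 2 by ring, h0]
    ring_nf
    simp only [hs, hi]
    ring
  · rw [h0, h2]
    ring_nf
    simp only [hs, hi]
    ring
  · rw [show Y ^ 4 = (Y ^ 2) ^ 2 by ring, h2]
    ring_nf
    simp only [hs, hi]
    ring

/-- The quadratic monomials under the substitution `F`. -/
lemma quadratic_gateF (hi : i ^ 2 = -1)
    (hX : X = (1 - i) / 2 * x + (1 - i) / 2 * y)
    (hY : Y = (-1 - i) / 2 * x + (1 + i) / 2 * y) :
    X ^ 2 = -i / 2 * (x + y) ^ 2 ∧ X * Y = (y ^ 2 - x ^ 2) / 2 ∧ Y ^ 2 = i / 2 * (y - x) ^ 2 := by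
  subst hX hY
  refine ⟨?_, ?_, ?_⟩ <;> ring_nf <;> simp only [hi] <;> ring

/-- The quartic monomials under the substitution `F`. -/
lemma quartic_gateF (hi : i ^ 2 = -1)
    (hX : X = (1 - i) / 2 * x + (1 - i) / 2 * y)
    (hY : Y = (-1 - i) / 2 * x + (1 + i) / 2 * y) :
    X ^ 4 = -(x + y) ^ 4 / 4 ∧ X ^ 2 * Y ^ 2 = (y ^ 2 - x ^ 2) ^ 2 / 4 ∧
      Y ^ 4 = -(y - x) ^ 4 / 4 := by
  obtain ⟨h0, h1, h2⟩ := quadratic_gateF hi hX hY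
  refine ⟨?_, ?_, ?_⟩
  · linear_combination (X ^ 2 + -i / 2 * (x + y) ^ 2) * h0 + (x + y) ^ 4 / 4 * hi
  · linear_combination (X * Y + (y ^ 2 - x ^ 2) / 2) * h1
  · linear_combination (Y ^ 2 + i / 2 * (y - x) ^ 2) * h2 + (y - x) ^ 4 / 4 * hi

end Substitution

/-! ### Explicit covariants in degrees 6, 7 and 10 -/

/-- A pair of binary forms of degree 7. -/
def pairForm (s x y : ℂ) : Fin 2 → ℂ :=
  ![-7 * x ^ 6 * y + 7 * s * x ^ 4 * y ^ 3 + 7 * x ^ 2 * y ^ 5 + s * y ^ 7,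
    -s * x ^ 7 - 7 * x ^ 5 * y ^ 2 - 7 * s * x ^ 3 * y ^ 4 + 7 * x * y ^ 6]

/-- The traceless matrix with given entries. -/
def tracelessMatrix (a b c : ℂ) : Matrix (Fin 2) (Fin 2) ℂ := !![a, b; c, -a]

/-- A traceless matrix of binary forms of degree 6. -/
def matrixFormSix (s x y : ℂ) : Matrix (Fin 2) (Fin 2) ℂ :=
  tracelessMatrix (6 * s * x ^ 5 * y + 20 * x ^ 3 * y ^ 3 + 6 * s * x * y ^ 5)
    (-5 * x ^ 6 + 15 * s * x ^ 4 * y ^ 2 - 15 * x ^ 2 * y ^ 4 - 3 * s * y ^ 6)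
    (3 * s * x ^ 6 + 15 * x ^ 4 * y ^ 2 - 15 * s * x ^ 2 * y ^ 4 + 5 * y ^ 6)

/-- A traceless matrix of binary forms of degree 10. -/
def matrixFormTen (s x y : ℂ) : Matrix (Fin 2) (Fin 2) ℂ :=
  tracelessMatrix
    (10 * s * x ^ 9 * y - 40 * x ^ 7 * y ^ 3 + 28 * s * x ^ 5 * y ^ 5 - 40 * x ^ 3 * y ^ 7 +
      10 * s * x * y ^ 9)
    (-5 * x ^ 10 - 25 * s * x ^ 8 * y ^ 2 + 70 * x ^ 6 * y ^ 4 + 70 * s * x ^ 4 * y ^ 6 +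
      15 * x ^ 2 * y ^ 8 + 3 * s * y ^ 10)
    (-3 * s * x ^ 10 - 15 * x ^ 8 * y ^ 2 - 70 * s * x ^ 6 * y ^ 4 - 70 * x ^ 4 * y ^ 6 +
      25 * s * x ^ 2 * y ^ 8 + 5 * y ^ 10)

/-- Reduction of the entries of `pairForm` to monomials of degree at most 4. -/
lemma pairForm_eq (s x y : ℂ) : pairForm s x y =
    ![y * ((-7 * x ^ 4 + 7 * y ^ 4) * x ^ 2 + (7 * s * x ^ 4 + s * y ^ 4) * y ^ 2),
      x * ((-s * x ^ 4 - 7 * s * y ^ 4) * x ^ 2 + (-7 * x ^ 4 + 7 * y ^ 4) * y ^ 2)] := by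
  rw [pairForm]
  congr 1
  · ring
  · congr 1
    ring

/-- Reduction of the entries of `matrixFormSix` to monomials of degree at most 4. -/
lemma matrixFormSix_eq (s x y : ℂ) : matrixFormSix s x y =
    tracelessMatrix ((6 * s * x ^ 4 + 20 * (x ^ 2 * y ^ 2) + 6 * s * y ^ 4) * (x * y))
      ((-5 * x ^ 4 - 15 * y ^ 4) * x ^ 2 + (15 * s * x ^ 4 - 3 * s * y ^ 4) * y ^ 2)
      ((3 * s * x ^ 4 - 15 * s * y ^ 4) * x ^ 2 + (15 * x ^ 4 + 5 * y ^ 4) * y ^ 2) := by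
  rw [matrixFormSix]
  congr 1 <;> ring

/-- Reduction of the entries of `matrixFormTen` to monomials of degree at most 4. -/
lemma matrixFormTen_eq (s x y : ℂ) : matrixFormTen s x y =
    tracelessMatrix
      ((10 * s * (x ^ 4 * x ^ 4) - 40 * (x ^ 4 * (x ^ 2 * y ^ 2)) + 28 * s * (x ^ 4 * y ^ 4) -
        40 * ((x ^ 2 * y ^ 2) * y ^ 4) + 10 * s * (y ^ 4 * y ^ 4)) * (x * y))
      ((-5 * (x ^ 4 * x ^ 4) + 70 * (x ^ 4 * y ^ 4) + 15 * (y ^ 4 * y ^ 4)) * x ^ 2 +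
        (-25 * s * (x ^ 4 * x ^ 4) + 70 * s * (x ^ 4 * y ^ 4) + 3 * s * (y ^ 4 * y ^ 4)) * y ^ 2)
      ((-3 * s * (x ^ 4 * x ^ 4) - 70 * s * (x ^ 4 * y ^ 4) + 25 * s * (y ^ 4 * y ^ 4)) * x ^ 2 +
        (-15 * (x ^ 4 * x ^ 4) - 70 * (x ^ 4 * y ^ 4) + 5 * (y ^ 4 * y ^ 4)) * y ^ 2) := by
  rw [matrixFormTen]
  congr 1 <;> ring

/-- Conjugation preserves tracelessness, so it is recorded as a linear action on the triple `(a, b,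
c)`; likewise for the other generators. -/
lemma conj_gateX_tracelessMatrix (a b c : ℂ) :
    star gateX.1 * tracelessMatrix a b c * gateX.1 = tracelessMatrix (-a) c b := by
  ext i j
  fin_cases i <;> fin_cases j <;>
    simp [gateX_coe, pauli, tracelessMatrix, Matrix.mul_apply, Fin.sum_univ_two,
      Matrix.star_apply] <;> grind [Complex.I_sq]

lemma conj_gateZ_tracelessMatrix (a b c : ℂ) :
    star gateZ.1 * tracelessMatrix a b c * gateZ.1 = tracelessMatrix a (-b) (-c) := by
  ext i j
  fin_cases i <;> fin_cases j <;>
    simp [gateZ_coe, pauli, tracelessMatrix, Matrix.mul_apply, Fin.sum_univ_two,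
      Matrix.star_apply] <;> grind [Complex.I_sq]

lemma conj_gateF_tracelessMatrix (a b c : ℂ) :
    star gateF.1 * tracelessMatrix a b c * gateF.1 =
      tracelessMatrix ((b + c) / 2) (-Complex.I / 2 * (2 * a - b + c))
        (Complex.I / 2 * (2 * a + b - c)) := by
  ext i j
  fin_cases i <;> fin_cases j <;>
    simp [gateF_coe, tracelessMatrix, Matrix.mul_apply, Fin.sum_univ_two,
      Matrix.star_apply, map_ofNat] <;> grind [Complex.I_sq]

lemma conj_gatePhiGalois_tracelessMatrix (a b c s : ℂ) (hs : s = (√5 : ℝ)) :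
    star gatePhiGalois.1 * tracelessMatrix a b c * gatePhiGalois.1 =
      tracelessMatrix
        (a / 2 - b * (1 - s + Complex.I * (s + 1)) / 8 - c * (1 - s - Complex.I * (s + 1)) / 8)
        (a * (1 - s + Complex.I * (s + 1)) / 4 - b * (s + 2 * Complex.I) / 4 - c / 4)
        (a * (1 - s - Complex.I * (s + 1)) / 4 + c * (2 * Complex.I - s) / 4 - b / 4) := by
  have h5 := sqrt_five_coe_sq
  have hI := Complex.I_sq
  rw [hs]
  ext i j
  fin_cases i <;> fin_cases j <;>
    simp [gatePhiGalois_coe, tracelessMatrix, Matrix.mul_apply, Fin.sum_univ_two,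
      Matrix.star_apply, map_ofNat] <;>
    generalize ((√5 : ℝ) : ℂ) = s at h5 ⊢ <;> ring_nf <;> simp only [h5, hI] <;> ring

/-- The matrix of binary forms `N` transforms by conjugation with `r` under the substitution
`g`. -/
def IsMatrixCovariant (g r : Matrix (Fin 2) (Fin 2) ℂ) (N : ℂ → ℂ → Matrix (Fin 2) (Fin 2) ℂ) :
    Prop :=
  ∀ x y, N (g 0 0 * x + g 1 0 * y) (g 0 1 * x + g 1 1 * y) = star r * N x y * r

lemma isMatrixCovariant_gateX (N : ℂ → ℂ → Matrix (Fin 2) (Fin 2) ℂ)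
    (h : ∀ x y, N (-Complex.I * y) (-Complex.I * x) = star gateX.1 * N x y * gateX.1) :
    IsMatrixCovariant gateX.1 gateX.1 N := by
  intro x y
  rw [← h]
  congr 1 <;> simp [gateX_coe, pauli]

lemma isMatrixCovariant_gateZ (N : ℂ → ℂ → Matrix (Fin 2) (Fin 2) ℂ)
    (h : ∀ x y, N (-Complex.I * x) (Complex.I * y) = star gateZ.1 * N x y * gateZ.1) :
    IsMatrixCovariant gateZ.1 gateZ.1 N := by
  intro x y
  rw [← h]
  congr 1 <;> simp [gateZ_coe, pauli]

lemma pow_reduction_sqrt_five {s : ℂ} (hs : s ^ 2 = 5) : s ^ 3 = 5 * s ∧ s ^ 4 = 25 :=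
  ⟨by linear_combination s * hs, by linear_combination (s ^ 2 + 5) * hs⟩

lemma pow_reduction_I {i : ℂ} (hi : i ^ 2 = -1) :
    i ^ 3 = -i ∧ i ^ 6 = -1 ∧ i ^ 7 = -i ∧ i ^ 10 = -1 :=
  ⟨by linear_combination i * hi, by linear_combination (i ^ 4 - i ^ 2 + 1) * hi,
    by linear_combination (i ^ 5 - i ^ 3 + i) * hi,
    by linear_combination (i ^ 8 - i ^ 6 + i ^ 4 - i ^ 2 + 1) * hi⟩

/-- Forms of degree 6 (spin 3) contain the Galois conjugate of the adjoint representation, and so do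
those of degree 10. The explicit copies are checked by expanding in monomials, modulo `s ^ 2 = 5`
and `i ^ 2 = -1`. -/
lemma isMatrixCovariant_matrixFormSix {p : SU2 × SU2} (hp : p ∈ galoisGenerators) :
    IsMatrixCovariant p.1.1 p.2.1 (matrixFormSix (√5 : ℝ)) := by
  have hs := sqrt_five_coe_sq
  have hi := Complex.I_sq
  obtain ⟨s3, s4⟩ := pow_reduction_sqrt_five hs
  obtain ⟨i3, i6, i7, i10⟩ := pow_reduction_I hi
  rcases hp with rfl | rfl | rfl | rfl
  · refine isMatrixCovariant_gateX _ fun x y => ?_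
    rw [matrixFormSix, matrixFormSix, conj_gateX_tracelessMatrix]
    congr 1 <;> ring_nf <;> simp only [i6] <;> ring
  · refine isMatrixCovariant_gateZ _ fun x y => ?_
    rw [matrixFormSix, matrixFormSix, conj_gateZ_tracelessMatrix]
    congr 1 <;> ring_nf <;> simp only [i6] <;> ring
  · intro x y
    simp only [gateF_coe, Matrix.of_apply, Matrix.cons_val', Matrix.cons_val_zero,
      Matrix.cons_val_one, Matrix.cons_val_fin_one]
    rw [← gateF_coe]
    obtain ⟨h0, h1, h2⟩ := quadratic_gateF hi rfl rfl (x := x) (y := y)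
    obtain ⟨g0, g2, g4⟩ := quartic_gateF hi rfl rfl (x := x) (y := y)
    rw [matrixFormSix_eq, g0, g2, g4, h0, h1, h2, matrixFormSix, conj_gateF_tracelessMatrix]
    congr 1 <;> ring
  · intro x y
    simp only [gatePhi_coe, Matrix.of_apply, Matrix.cons_val', Matrix.cons_val_zero,
      Matrix.cons_val_one, Matrix.cons_val_fin_one]
    obtain ⟨h0, h1, h2⟩ := quadratic_gatePhi hs hi rfl rfl (x := x) (y := y)
    obtain ⟨g0, g2, g4⟩ := quartic_gatePhi hs hi rfl rfl (x := x) (y := y)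
    rw [matrixFormSix_eq, g0, g2, g4, h0, h1, h2, matrixFormSix,
      conj_gatePhiGalois_tracelessMatrix _ _ _ _ rfl]
    clear g0 g2 g4 h0 h1 h2
    generalize ((√5 : ℝ) : ℂ) = s at *
    congr 1 <;> ring_nf <;> simp only [hs, hi, s3] <;> ring

set_option maxRecDepth 20000 in
lemma isMatrixCovariant_matrixFormTen {p : SU2 × SU2} (hp : p ∈ galoisGenerators) :
    IsMatrixCovariant p.1.1 p.2.1 (matrixFormTen (√5 : ℝ)) := by
  have hs := sqrt_five_coe_sq
  have hi := Complex.I_sq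
  obtain ⟨s3, s4⟩ := pow_reduction_sqrt_five hs
  obtain ⟨i3, i6, i7, i10⟩ := pow_reduction_I hi
  rcases hp with rfl | rfl | rfl | rfl
  · refine isMatrixCovariant_gateX _ fun x y => ?_
    rw [matrixFormTen, matrixFormTen, conj_gateX_tracelessMatrix]
    congr 1 <;> ring_nf <;> simp only [i10] <;> ring
  · refine isMatrixCovariant_gateZ _ fun x y => ?_
    rw [matrixFormTen, matrixFormTen, conj_gateZ_tracelessMatrix]
    congr 1 <;> ring_nf <;> simp only [i10] <;> ring
  · intro x y
    simp only [gateF_coe, Matrix.of_apply, Matrix.cons_val', Matrix.cons_val_zero,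
      Matrix.cons_val_one, Matrix.cons_val_fin_one]
    rw [← gateF_coe]
    obtain ⟨h0, h1, h2⟩ := quadratic_gateF hi rfl rfl (x := x) (y := y)
    obtain ⟨g0, g2, g4⟩ := quartic_gateF hi rfl rfl (x := x) (y := y)
    rw [matrixFormTen_eq, g0, g2, g4, h0, h1, h2, matrixFormTen, conj_gateF_tracelessMatrix]
    congr 1 <;> ring
  · intro x y
    simp only [gatePhi_coe, Matrix.of_apply, Matrix.cons_val', Matrix.cons_val_zero,
      Matrix.cons_val_one, Matrix.cons_val_fin_one]
    obtain ⟨h0, h1, h2⟩ := quadratic_gatePhi hs hi rfl rfl (x := x) (y := y)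
    obtain ⟨g0, g2, g4⟩ := quartic_gatePhi hs hi rfl rfl (x := x) (y := y)
    rw [matrixFormTen_eq, g0, g2, g4, h0, h1, h2, matrixFormTen,
      conj_gatePhiGalois_tracelessMatrix _ _ _ _ rfl]
    clear g0 g2 g4 h0 h1 h2
    generalize ((√5 : ℝ) : ℂ) = s at *
    congr 1 <;> ring_nf <;> simp only [hs, hi, s3, s4, i3] <;> ring

lemma isCovariant_pairForm {p : SU2 × SU2} (hp : p ∈ galoisGenerators) :
    IsCovariant p.1.1 p.2.1 fun k x y => pairForm (√5 : ℝ) x y k := by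
  have hs := sqrt_five_coe_sq
  have hi := Complex.I_sq
  obtain ⟨s3, s4⟩ := pow_reduction_sqrt_five hs
  obtain ⟨i3, i6, i7, i10⟩ := pow_reduction_I hi
  rcases hp with rfl | rfl | rfl | rfl
  · intro k x y
    fin_cases k <;> simp [gateX_coe, pauli, Fin.sum_univ_two, pairForm] <;> ring_nf <;>
      simp only [i7] <;> ring
  · intro k x y
    fin_cases k <;> simp [gateZ_coe, pauli, Fin.sum_univ_two, pairForm] <;> ring_nf <;>
      simp only [i7] <;> ring
  · intro k x y
    simp only [gateF_coe, Matrix.of_apply, Matrix.cons_val', Matrix.cons_val_zero,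
      Matrix.cons_val_one, Matrix.cons_val_fin_one]
    obtain ⟨h0, h1, h2⟩ := quadratic_gateF hi rfl rfl (x := x) (y := y)
    obtain ⟨g0, g2, g4⟩ := quartic_gateF hi rfl rfl (x := x) (y := y)
    rw [pairForm_eq, g0, g4, h0, h2]
    fin_cases k <;> simp [Fin.sum_univ_two, pairForm] <;> ring_nf <;> simp only [hi] <;> ring
  · intro k x y
    simp only [gatePhi_coe, gatePhiGalois_coe, Matrix.of_apply, Matrix.cons_val',
      Matrix.cons_val_zero, Matrix.cons_val_one, Matrix.cons_val_fin_one]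
    obtain ⟨h0, h1, h2⟩ := quadratic_gatePhi hs hi rfl rfl (x := x) (y := y)
    obtain ⟨g0, g2, g4⟩ := quartic_gatePhi hs hi rfl rfl (x := x) (y := y)
    rw [pairForm_eq, g0, g4, h0, h2]
    clear g0 g2 g4 h0 h1 h2
    fin_cases k <;> simp [Fin.sum_univ_two, pairForm] <;>
      generalize ((√5 : ℝ) : ℂ) = s at * <;> ring_nf <;>
      simp only [hs, hi, s3, s4, i3] <;> ring

/-! ### Existence of covariants -/

/-- The binary form `f` is invariant under the substitution `g`. -/
def IsInvariantForm (g : Matrix (Fin 2) (Fin 2) ℂ) (f : ℂ → ℂ → ℂ) : Prop :=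
  ∀ x y, f (g 0 0 * x + g 1 0 * y) (g 0 1 * x + g 1 1 * y) = f x y

/-- There is a covariant pair of real binary forms of degree `n` which is nonzero at `(1, 0)`. -/
def HasCovariantPair (n : ℕ) : Prop :=
  ∃ P : Fin 2 → ℂ → ℂ → ℂ, (∀ k, P k ∈ realForms n) ∧
    (∀ p ∈ galoisGenerators, IsCovariant p.1.1 p.2.1 P) ∧ (fun k => P k 1 0) ≠ 0

lemma HasCovariantPair.mul_form {m n : ℕ} {f : ℂ → ℂ → ℂ} (hf : f ∈ realForms m)
    (hinv : ∀ p ∈ galoisGenerators, IsInvariantForm p.1.1 f) (h1 : f 1 0 ≠ 0)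
    (h : HasCovariantPair n) : HasCovariantPair (m + n) := by
  obtain ⟨P, hP, hcov, hne⟩ := h
  refine ⟨fun k => f * P k, fun k => mul_mem_realForms hf (hP k), fun p hp k x y => ?_,
    fun h => hne ?_⟩
  · simp only [Pi.mul_apply, hinv p hp x y, hcov p hp k x y, Fin.sum_univ_two]
    ring
  · funext k
    exact (mul_eq_zero.1 (congrFun h k)).resolve_left h1

/-- The product of a pair of forms and a matrix of forms. -/
def formVecMul (P : Fin 2 → ℂ → ℂ → ℂ) (N : ℂ → ℂ → Matrix (Fin 2) (Fin 2) ℂ) :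
    Fin 2 → ℂ → ℂ → ℂ :=
  fun k x y => Matrix.vecMul (fun l => P l x y) (N x y) k

lemma formVecMul_mem_realForms {m n : ℕ} {P : Fin 2 → ℂ → ℂ → ℂ}
    {N : ℂ → ℂ → Matrix (Fin 2) (Fin 2) ℂ} (hP : ∀ k, P k ∈ realForms m)
    (hN : ∀ i j, (fun x y => N x y i j) ∈ realForms n) (k : Fin 2) :
    formVecMul P N k ∈ realForms (m + n) := by
  have : formVecMul P N k =
      P 0 * (fun x y => N x y 0 k) + P 1 * (fun x y => N x y 1 k) := by
    funext x y
    simp [formVecMul, Matrix.vecMul, dotProduct, Fin.sum_univ_two]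
  rw [this]
  exact add_mem (mul_mem_realForms (hP 0) (hN 0 k)) (mul_mem_realForms (hP 1) (hN 1 k))

lemma IsCovariant.formVecMul {g : Matrix (Fin 2) (Fin 2) ℂ} {r : SU2} {P : Fin 2 → ℂ → ℂ → ℂ}
    {N : ℂ → ℂ → Matrix (Fin 2) (Fin 2) ℂ} (hP : IsCovariant g r.1 P)
    (hN : IsMatrixCovariant g r.1 N) : IsCovariant g r.1 (formVecMul P N) := by
  intro k x y
  have hr : r.1 * star r.1 = 1 :=
    Matrix.mem_unitaryGroup_iff.1 (Matrix.mem_specialUnitaryGroup_iff.1 r.2).1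
  have h1 : (fun l => P l (g 0 0 * x + g 1 0 * y) (g 0 1 * x + g 1 1 * y)) =
      Matrix.vecMul (fun l => P l x y) r.1 := by
    funext l
    rw [hP l x y]
    simp only [Matrix.vecMul, dotProduct, mul_comm]
  have h2 : r.1 * (star r.1 * N x y * r.1) = N x y * r.1 := by
    rw [← mul_assoc, ← mul_assoc, hr, one_mul]
  -- As a row vector `P` becomes `P r` and `N` becomes `r* N r`, so the inner `r r*` cancels.
  rw [IcosahedralCodes.formVecMul, h1, hN, Matrix.vecMul_vecMul, h2, ← Matrix.vecMul_vecMul]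
  simp only [Matrix.vecMul, dotProduct, IcosahedralCodes.formVecMul, mul_comm]

/-- Invertibility of `N 1 0` keeps the pair nonzero at `(1, 0)`, so products can be iterated without
cancellation. -/
lemma HasCovariantPair.mul_matrix {m n : ℕ} {N : ℂ → ℂ → Matrix (Fin 2) (Fin 2) ℂ}
    (hN : ∀ i j, (fun x y => N x y i j) ∈ realForms m)
    (hcov : ∀ p ∈ galoisGenerators, IsMatrixCovariant p.1.1 p.2.1 N) (h1 : (N 1 0).det ≠ 0)
    (h : HasCovariantPair n) : HasCovariantPair (n + m) := by
  obtain ⟨P, hP, hPcov, hne⟩ := h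
  exact ⟨formVecMul P N, formVecMul_mem_realForms hP hN,
    fun p hp => (hPcov p hp).formVecMul (hcov p hp),
    fun h => hne (Matrix.eq_zero_of_vecMul_eq_zero h1 h)⟩

lemma det_SU2 (r : SU2) : r.1.det = 1 := (Matrix.mem_specialUnitaryGroup_iff.1 r.2).2

lemma IsMatrixCovariant.det {g : Matrix (Fin 2) (Fin 2) ℂ} {r : SU2}
    {N : ℂ → ℂ → Matrix (Fin 2) (Fin 2) ℂ} (hN : IsMatrixCovariant g r.1 N) :
    IsInvariantForm g fun x y => (N x y).det := by
  intro x y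
  have hr : star r.1 * r.1 = 1 :=
    Matrix.mem_unitaryGroup_iff'.1 (Matrix.mem_specialUnitaryGroup_iff.1 r.2).1
  have h := congrArg Matrix.det hr
  rw [Matrix.det_mul, Matrix.det_one] at h
  simp only [hN x y, Matrix.det_mul]
  linear_combination (N x y).det * h

lemma det_mem_realForms {m : ℕ} {N : ℂ → ℂ → Matrix (Fin 2) (Fin 2) ℂ}
    (hN : ∀ i j, (fun x y => N x y i j) ∈ realForms m) :
    (fun x y => (N x y).det) ∈ realForms (m + m) := by
  have : (fun x y => (N x y).det) = (fun x y => N x y 0 0) * (fun x y => N x y 1 1) -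
      (fun x y => N x y 0 1) * (fun x y => N x y 1 0) := by
    funext x y
    simp [Matrix.det_fin_two]
  rw [this]
  exact sub_mem (mul_mem_realForms (hN 0 0) (hN 1 1)) (mul_mem_realForms (hN 0 1) (hN 1 0))

/-- The wedge of two pairs is multiplied by `det r = 1`. -/
lemma IsCovariant.wedge {g : Matrix (Fin 2) (Fin 2) ℂ} {r : SU2} {P Q : Fin 2 → ℂ → ℂ → ℂ}
    (hP : IsCovariant g r.1 P) (hQ : IsCovariant g r.1 Q) :
    IsInvariantForm g (P 0 * Q 1 - P 1 * Q 0) := by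
  intro x y
  have hd := det_SU2 r
  rw [Matrix.det_fin_two] at hd
  simp only [Pi.sub_apply, Pi.mul_apply, hP _ x y, hQ _ x y, Fin.sum_univ_two]
  linear_combination (P 0 x y * Q 1 x y - P 1 x y * Q 0 x y) * hd

lemma sum_mem_realForms {n : ℕ} (c : Fin (n + 1) → ℝ) :
    (fun x y => ∑ w, (c w : ℂ) * (x ^ (n - (w : ℕ)) * y ^ (w : ℕ))) ∈ realForms n := by
  have : (fun x y => ∑ w, (c w : ℂ) * (x ^ (n - (w : ℕ)) * y ^ (w : ℕ))) =
      ∑ w, c w • monomialForm n w := by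
    funext x y
    simp [monomialForm, Finset.sum_apply]
  rw [this]
  exact Submodule.sum_mem _ fun w _ => Submodule.smul_mem _ _
    (Submodule.subset_span (Set.mem_range_self w))

/-! ### Degree-raising operations from the explicit covariants -/

lemma pairForm_mem_realForms (k : Fin 2) :
    (fun x y => pairForm (√5 : ℝ) x y k) ∈ realForms 7 := by
  fin_cases k
  · convert sum_mem_realForms (n := 7) ![0, -7, 0, 7 * √5, 0, 7, 0, √5] using 3
    simp [pairForm, Fin.sum_univ_succ]
    ring
  · convert sum_mem_realForms (n := 7) ![-√5, 0, -7, 0, -7 * √5, 0, 7, 0] using 3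
    simp [pairForm, Fin.sum_univ_succ]
    ring

lemma matrixFormSix_mem_realForms (i j : Fin 2) :
    (fun x y => matrixFormSix (√5 : ℝ) x y i j) ∈ realForms 6 := by
  have h : (fun x y => matrixFormSix (√5 : ℝ) x y 0 0) ∈ realForms 6 := by
    convert sum_mem_realForms (n := 6) ![0, 6 * √5, 0, 20, 0, 6 * √5, 0] using 3
    simp [matrixFormSix, tracelessMatrix, Fin.sum_univ_succ]
    ring
  fin_cases i <;> fin_cases j
  · exact h
  · convert sum_mem_realForms (n := 6) ![-5, 0, 15 * √5, 0, -15, 0, -3 * √5] using 3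
    simp [matrixFormSix, tracelessMatrix, Fin.sum_univ_succ]
    ring
  · convert sum_mem_realForms (n := 6) ![3 * √5, 0, 15, 0, -15 * √5, 0, 5] using 3
    simp [matrixFormSix, tracelessMatrix, Fin.sum_univ_succ]
    ring
  · exact neg_mem h

lemma matrixFormTen_mem_realForms (i j : Fin 2) :
    (fun x y => matrixFormTen (√5 : ℝ) x y i j) ∈ realForms 10 := by
  have h : (fun x y => matrixFormTen (√5 : ℝ) x y 0 0) ∈ realForms 10 := by
    convert sum_mem_realForms (n := 10)
      ![0, 10 * √5, 0, -40, 0, 28 * √5, 0, -40, 0, 10 * √5, 0] using 3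
    simp [matrixFormTen, tracelessMatrix, Fin.sum_univ_succ]
    ring
  fin_cases i <;> fin_cases j
  · exact h
  · convert sum_mem_realForms (n := 10)
      ![-5, 0, -25 * √5, 0, 70, 0, 70 * √5, 0, 15, 0, 3 * √5] using 3
    simp [matrixFormTen, tracelessMatrix, Fin.sum_univ_succ]
    ring
  · convert sum_mem_realForms (n := 10)
      ![-3 * √5, 0, -15, 0, -70 * √5, 0, -70, 0, 25 * √5, 0, 5] using 3
    simp [matrixFormTen, tracelessMatrix, Fin.sum_univ_succ]
    ring
  · exact neg_mem h

lemma det_matrixFormSix_ne_zero : (matrixFormSix (√5 : ℝ) 1 0).det ≠ 0 := by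
  simp [matrixFormSix, tracelessMatrix, Matrix.det_fin_two]

lemma det_matrixFormTen_ne_zero : (matrixFormTen (√5 : ℝ) 1 0).det ≠ 0 := by
  simp [matrixFormTen, tracelessMatrix, Matrix.det_fin_two]

lemma hasCovariantPair_seven : HasCovariantPair 7 :=
  ⟨_, pairForm_mem_realForms, fun _ hp => isCovariant_pairForm hp, fun h => by
    have := congrFun h 1
    simp [pairForm] at this⟩

lemma HasCovariantPair.add_six {n : ℕ} (h : HasCovariantPair n) : HasCovariantPair (n + 6) :=
  h.mul_matrix (N := matrixFormSix (√5 : ℝ)) matrixFormSix_mem_realForms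
    (fun _ hp => isMatrixCovariant_matrixFormSix hp) det_matrixFormSix_ne_zero

lemma HasCovariantPair.add_ten {n : ℕ} (h : HasCovariantPair n) : HasCovariantPair (n + 10) :=
  h.mul_matrix (N := matrixFormTen (√5 : ℝ)) matrixFormTen_mem_realForms
    (fun _ hp => isMatrixCovariant_matrixFormTen hp) det_matrixFormTen_ne_zero

lemma HasCovariantPair.add_twelve {n : ℕ} (h : HasCovariantPair n) : HasCovariantPair (12 + n) :=
  h.mul_form (m := 6 + 6) (f := fun x y => (matrixFormSix (√5 : ℝ) x y).det)
    (det_mem_realForms matrixFormSix_mem_realForms)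
    (fun _ hp => (isMatrixCovariant_matrixFormSix hp).det) det_matrixFormSix_ne_zero

/-- The invariant is the wedge of the degree-7 pair with its product by the degree-6 matrix. -/
lemma HasCovariantPair.add_twenty {n : ℕ} (h : HasCovariantPair n) :
    HasCovariantPair (20 + n) := by
  refine h.mul_form (m := 7 + (7 + 6)) (f :=
    (fun x y => pairForm (√5 : ℝ) x y 0) *
        formVecMul (fun k x y => pairForm (√5 : ℝ) x y k) (matrixFormSix (√5 : ℝ)) 1 -
      (fun x y => pairForm (√5 : ℝ) x y 1) *
        formVecMul (fun k x y => pairForm (√5 : ℝ) x y k) (matrixFormSix (√5 : ℝ)) 0)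
    (sub_mem ?_ ?_) (fun p hp => (isCovariant_pairForm hp).wedge
      ((isCovariant_pairForm hp).formVecMul (isMatrixCovariant_matrixFormSix hp))) ?_
  · exact mul_mem_realForms (pairForm_mem_realForms 0)
      (formVecMul_mem_realForms pairForm_mem_realForms matrixFormSix_mem_realForms 1)
  · exact mul_mem_realForms (pairForm_mem_realForms 1)
      (formVecMul_mem_realForms pairForm_mem_realForms matrixFormSix_mem_realForms 0)
  · simp [pairForm, formVecMul, matrixFormSix, tracelessMatrix, Matrix.vecMul, dotProduct]

/-- Every odd degree outside the exceptional set carries a covariant pair. -/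
lemma hasCovariantPair_of_odd {n : ℕ} (hn : Odd n)
    (hne : n ∉ ({1, 3, 5, 9, 11, 15, 21} : Finset ℕ)) : HasCovariantPair n := by
  induction n using Nat.strong_induction_on with
  | _ n ih =>
    have h7 := hasCovariantPair_seven
    have h13 : HasCovariantPair 13 := h7.add_six
    have h17 : HasCovariantPair 17 := h7.add_ten
    have h23 : HasCovariantPair 23 := h13.add_ten
    simp only [Finset.mem_insert, Finset.mem_singleton, not_or] at hne ih
    obtain ⟨k, rfl⟩ := hn
    -- From 35 on, subtracting 12 gives at least 23, beyond the last exception 21. The ten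
    -- admissible degrees below 35 are reached directly from 7, 13, 17 and 23.
    by_cases h : 2 * k + 1 < 35
    · have hk : k = 3 ∨ k = 6 ∨ k = 8 ∨ k = 9 ∨ k = 11 ∨ k = 12 ∨ k = 13 ∨ k = 14 ∨ k = 15 ∨
          k = 16 := by omega
      rcases hk with rfl | rfl | rfl | rfl | rfl | rfl | rfl | rfl | rfl | rfl
      exacts [h7, h13, h17, h7.add_twelve, h23, h13.add_twelve, h7.add_twenty, h17.add_twelve,
        h7.add_twelve.add_twelve, h13.add_twenty]
    · have := (ih (2 * k + 1 - 12) (by omega) ⟨k - 6, by omega⟩ (by omega)).add_twelve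
      rwa [show 12 + (2 * k + 1 - 12) = 2 * k + 1 by omega] at this

end IcosahedralCodes

theorem mainTheorem1 (n : ℕ) (hn : Odd n)
    (hne : n ∉ ({1, 3, 5, 9, 11, 15, 21} : Finset ℕ)) :
    ∃ u : Fin 2 → SpinSpace n,
      Orthonormal ℂ u ∧
      (∀ k w, (u k w).im = 0) ∧
      TransformsInPiBarTwo (Submodule.span ℂ (Set.range u)) ∧
      ∃ C : Submodule ℂ (Qubits n),
        C = (Submodule.span ℂ (Set.range u)).map (dickeMap n) ∧
        IsCode n 2 3 C ∧
        IsPermutationallyInvariant C ∧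
        ImplementsStronglyTransversally twoIStar (fun k => dickeMap n (u k)) ∧
        (∃ b : Fin 2 → Qubits n, Orthonormal ℂ b ∧ Submodule.span ℂ (Set.range b) = C ∧
          ImplementsStronglyTransversally twoI b) := by
  obtain ⟨P, hP, hcov, h0⟩ := hasCovariantPair_of_odd hn hne
  obtain ⟨k, hk⟩ := Function.ne_iff.1 h0
  obtain ⟨u, hu, hreal, hcl⟩ := exists_orthonormal_of_covariant hP hcov ⟨k, 1, 0, hk⟩
  have h2 : 2 ≤ n := by
    obtain ⟨m, rfl⟩ := hn
    have : m ≠ 0 := by rintro rfl; simp at hne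
    omega
  exact ⟨u, hu, hreal, transformsInPiBarTwo_span hu hcl, code_of_covariant h2 hu hcl⟩
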